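/- Let $n\ge 1$. We use the tropical semiring $(\mathbb R,\oplus,\odot)=(\mathbb R,\min,+)$. A symmetric matrix $A\in\mathbb R^{n\times n}$ is said to have \emph{symmetric tropical rank $2$} if, for every $3\times 3$ minor of the generic symmetric matrix $(x_{ij})$, $x_{ij}=x_{ji}$, regarded as a polynomial with rational coefficients (all of valuation $0$) in the variables $x_{ij}$, $i\le j$, the minimum in its tropicalization evaluated at $A$ is attained by at least two different monomials. (Thus matrices of rank at most $2$ are meant.) \emph{Trees.} Consider metric trees with $2n$ leaves labelled $1,\dots,n,1',\dots,n'$, whose leaf edges are regarded as infinite and whose internal edges have positive finite lengths; such a tree is recorded by the metric tree formed by its internal vertices and edges, which is the union of the paths between the points where leaves are attached, together with these attaching points. Isomorphisms are isometries preserving the labelled attaching points. A tree is \emph{bicolored} if for each internal edge both of the sets of leaves into which its removal splits the leaves contain an unprimed and a primed label. A bicolored tree is a \emph{symbic tree} if it has an isometric involution that swaps the leaves $i$ and $i'$ for all $i$, and the fixed points of this involution form a path (possibly a single point). \emph{The tree of a matrix.} Let $P_A\subset\mathbb R^n/\mathbb R(1,\dots,1)$ be the tropical convex hull of the columns of $A$,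 i.e. the set of classes of all tropical linear combinations of the columns, with the metric $d(x,y)=\max_i(x_i-y_i)-\min_i(x_i-y_i)$. If $A$ is symmetric of symmetric tropical rank $2$, there is exactly one way to attach to $P_A$ infinite rays of directions $e_1,\dots,e_n$, one for each $j$, that makes it balanced: at each point of $P_A$ the directions $e_S=\sum_{j\in S}e_j$ ($\emptyset\ne S\subsetneq\{1,\dots,n\}$) of all edges and rays emanating from it sum to $0$ modulo $(1,\dots,1)$. The tree $T_A$ is $P_A$ with the leaf $i$ attached at the $i$-th column and the leaf $j'$ attached at the point where the ray of direction $e_j$ is attached. \textbf{Theorem.} (1) If $A\in\mathbb R^{n\times n}$ is symmetric of symmetric tropical rank $2$, then $T_A$ is well defined (that is, the balancing rays exist and are unique) and is a symbic tree. (2) Conversely, for every symbic tree $T$ with leaves $1,\dots,n,1',\dots,n'$ there is a symmetric matrix $A\in\mathbb R^{n\times n}$ of symmetric tropical rank $2$ with $T_A\cong T$, and $A$ is unique up to simultaneous tropical scaling of rows and columns: a symmetric matrix $B$ of symmetric tropical rank $2$ satisfies $T_B\cong T$ if and only if there is $c\in\mathbb R^n$ with $B_{ij}=c_i+A_{ij}+c_j$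 for all $i,j$. -/

import Mathlib

/-! ### Symmetric tropical rank -/

/-- The minor with row set `I` and column set `J` of the generic symmetric `n × n` matrix, as a
polynomial in the variables `x_{ij}`, `i ≤ j` (the entry at `(i, j)` is `x_{min i j, max i j}`). -/
noncomputable def symMinor {n r : ℕ} (I J : Fin r ↪o Fin n) : MvPolynomial (Fin n × Fin n) ℚ :=
  (Matrix.of fun a b =>
    (MvPolynomial.X (min (I a) (J b), max (I a) (J b)) : MvPolynomial (Fin n × Fin n) ℚ)).det

/-- The value at `A` of the tropicalized monomial with exponent vector `m` (the coefficients are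
nonzero rationals, which have valuation `0`). -/
noncomputable def tropMonomial {n : ℕ} (A : Matrix (Fin n) (Fin n) ℝ)
    (m : Fin n × Fin n →₀ ℕ) : ℝ :=
  ∑ p, (m p : ℝ) * A p.1 p.2

/-- The minimum in the tropicalization of `f` at `A` is attained at least twice, that is, at two
different monomials of `f`. -/
def MinAttainedTwice {n : ℕ} (A : Matrix (Fin n) (Fin n) ℝ)
    (f : MvPolynomial (Fin n × Fin n) ℚ) : Prop :=
  ∃ m₁ ∈ f.support, ∃ m₂ ∈ f.support, m₁ ≠ m₂ ∧
    (∀ m ∈ f.support, tropMonomial A m₁ ≤ tropMonomial A m) ∧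
    (∀ m ∈ f.support, tropMonomial A m₂ ≤ tropMonomial A m)

/-- The symmetric matrix `A` has symmetric tropical rank `r` in the sense that the minimum is
attained twice in all `(r + 1) × (r + 1)` symmetric minors (so the rank is at most `r`). -/
def HasSymTropRank {n : ℕ} (r : ℕ) (A : Matrix (Fin n) (Fin n) ℝ) : Prop :=
  A.IsSymm ∧ ∀ I J : Fin (r + 1) ↪o Fin n, MinAttainedTwice A (symMinor I J)

/-! ### The tropical projective torus with the tropical Hilbert metric -/

/-- `ℝⁿ / ℝ(1, …, 1)`. -/
def TropTorus (n : ℕ) : Type := (Fin n → ℝ) ⧸ Submodule.span ℝ {(1 : Fin n → ℝ)}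

noncomputable instance (n : ℕ) : AddCommGroup (TropTorus n) :=
  inferInstanceAs (AddCommGroup ((Fin n → ℝ) ⧸ Submodule.span ℝ {(1 : Fin n → ℝ)}))

noncomputable instance (n : ℕ) : Module ℝ (TropTorus n) :=
  inferInstanceAs (Module ℝ ((Fin n → ℝ) ⧸ Submodule.span ℝ {(1 : Fin n → ℝ)}))

/-- The class of a vector modulo tropical scaling. -/
noncomputable def TropTorus.mk {n : ℕ} : (Fin n → ℝ) →ₗ[ℝ] TropTorus n :=
  Submodule.mkQ (Submodule.span ℝ {(1 : Fin n → ℝ)})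

theorem TropTorus.mk_surjective {n : ℕ} : Function.Surjective (TropTorus.mk (n := n)) :=
  Submodule.mkQ_surjective _

theorem TropTorus.mk_eq_mk {n : ℕ} {x y : Fin n → ℝ} :
    TropTorus.mk x = TropTorus.mk y ↔ ∃ c : ℝ, ∀ i, x i = c + y i := by
  have h : TropTorus.mk x = TropTorus.mk y ↔ x - y ∈ Submodule.span ℝ {(1 : Fin n → ℝ)} :=
    Submodule.Quotient.eq _
  rw [h, Submodule.mem_span_singleton]
  constructor
  · rintro ⟨c, hc⟩
    refine ⟨c, fun i => ?_⟩
    have := congrFun hc i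
    simp at this
    linarith
  · rintro ⟨c, hc⟩
    refine ⟨c, funext fun i => ?_⟩
    simp only [Pi.smul_apply, Pi.one_apply, Pi.sub_apply, smul_eq_mul, mul_one]
    linarith [hc i]

/-- `d(x, y) = max_i (x_i - y_i) - min_i (x_i - y_i)`. -/
noncomputable def hilbertDist {n : ℕ} (x y : Fin n → ℝ) : ℝ :=
  (⨆ i, (x i - y i)) - ⨅ i, (x i - y i)

theorem hilbertDist_le_iff {n : ℕ} [NeZero n] {x y : Fin n → ℝ} {b : ℝ} :
    hilbertDist x y ≤ b ↔ ∀ i j, (x i - y i) - (x j - y j) ≤ b := by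
  have hne : Nonempty (Fin n) := ⟨0⟩
  unfold hilbertDist
  constructor
  · intro h i j
    have h1 := le_ciSup (Set.finite_range fun i => x i - y i).bddAbove i
    have h2 := ciInf_le (Set.finite_range fun i => x i - y i).bddBelow j
    linarith
  · intro h
    have h1 : (⨆ i, (x i - y i)) - b ≤ ⨅ j, (x j - y j) := by
      refine le_ciInf fun j => ?_
      have : (⨆ i, (x i - y i)) ≤ b + (x j - y j) := ciSup_le fun i => by linarith [h i j]
      linarith
    linarith

theorem hilbertDist_congr {n : ℕ} {x y x' y' : Fin n → ℝ}
    (hx : TropTorus.mk x = TropTorus.mk x') (hy : TropTorus.mk y = TropTorus.mk y') :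
    hilbertDist x y = hilbertDist x' y' := by
  obtain ⟨a, ha⟩ := TropTorus.mk_eq_mk.1 hx
  obtain ⟨b, hb⟩ := TropTorus.mk_eq_mk.1 hy
  rcases Nat.eq_zero_or_pos n with rfl | hn
  · simp [hilbertDist]
  · have : NeZero n := ⟨hn.ne'⟩
    refine le_antisymm (hilbertDist_le_iff.2 fun i j => ?_) (hilbertDist_le_iff.2 fun i j => ?_)
    · have := hilbertDist_le_iff.1 (le_refl (hilbertDist x' y')) i j
      rw [ha, ha, hb, hb]; linarith
    · have := hilbertDist_le_iff.1 (le_refl (hilbertDist x y)) i j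
      rw [ha, ha, hb, hb] at this; linarith

theorem hilbertDist_self {n : ℕ} (x : Fin n → ℝ) : hilbertDist x x = 0 := by
  rcases Nat.eq_zero_or_pos n with rfl | hn
  · simp [hilbertDist]
  · have : Nonempty (Fin n) := ⟨⟨0, hn⟩⟩
    simp [hilbertDist]

theorem hilbertDist_comm {n : ℕ} (x y : Fin n → ℝ) : hilbertDist x y = hilbertDist y x := by
  rcases Nat.eq_zero_or_pos n with rfl | hn
  · simp [hilbertDist]
  · have : NeZero n := ⟨hn.ne'⟩
    refine le_antisymm (hilbertDist_le_iff.2 fun i j => ?_) (hilbertDist_le_iff.2 fun i j => ?_)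
    · linarith [hilbertDist_le_iff.1 (le_refl (hilbertDist y x)) j i]
    · linarith [hilbertDist_le_iff.1 (le_refl (hilbertDist x y)) j i]

theorem hilbertDist_triangle {n : ℕ} (x y z : Fin n → ℝ) :
    hilbertDist x z ≤ hilbertDist x y + hilbertDist y z := by
  rcases Nat.eq_zero_or_pos n with rfl | hn
  · simp [hilbertDist]
  · have : NeZero n := ⟨hn.ne'⟩
    refine hilbertDist_le_iff.2 fun i j => ?_
    linarith [hilbertDist_le_iff.1 (le_refl (hilbertDist x y)) i j,
      hilbertDist_le_iff.1 (le_refl (hilbertDist y z)) i j]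

theorem mk_eq_of_hilbertDist_eq_zero {n : ℕ} {x y : Fin n → ℝ} (h : hilbertDist x y = 0) :
    TropTorus.mk x = TropTorus.mk y := by
  rcases Nat.eq_zero_or_pos n with rfl | hn
  · exact congrArg _ (Subsingleton.elim x y)
  · have : NeZero n := ⟨hn.ne'⟩
    refine TropTorus.mk_eq_mk.2 ⟨x 0 - y 0, fun i => ?_⟩
    linarith [hilbertDist_le_iff.1 h.le i 0, hilbertDist_le_iff.1 h.le 0 i]

/-- The tropical projective torus carries the tropical Hilbert metric. -/
noncomputable instance (n : ℕ) : MetricSpace (TropTorus n) where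
  dist p q := Quotient.liftOn₂' p q hilbertDist fun _ _ _ _ h₁ h₂ =>
    hilbertDist_congr (Quotient.sound' h₁) (Quotient.sound' h₂)
  dist_self p := by
    obtain ⟨x, rfl⟩ := TropTorus.mk_surjective p
    exact hilbertDist_self x
  dist_comm p q := by
    obtain ⟨x, rfl⟩ := TropTorus.mk_surjective p
    obtain ⟨y, rfl⟩ := TropTorus.mk_surjective q
    exact hilbertDist_comm x y
  dist_triangle p q r := by
    obtain ⟨x, rfl⟩ := TropTorus.mk_surjective p
    obtain ⟨y, rfl⟩ := TropTorus.mk_surjective q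
    obtain ⟨z, rfl⟩ := TropTorus.mk_surjective r
    exact hilbertDist_triangle x y z
  eq_of_dist_eq_zero {p q} h := by
    obtain ⟨x, rfl⟩ := TropTorus.mk_surjective p
    obtain ⟨y, rfl⟩ := TropTorus.mk_surjective q
    exact mk_eq_of_hilbertDist_eq_zero h

theorem TropTorus.dist_mk {n : ℕ} (x y : Fin n → ℝ) :
    dist (TropTorus.mk x) (TropTorus.mk y) = hilbertDist x y := rfl

/-! ### The tropical convex hull of the columns and its balancing rays -/

/-- The tropical convex hull of the columns of `A` modulo tropical scaling: the classes of all
tropical linear combinations `⊕ᵢ cᵢ ⊙ (i-th column)`. -/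
def tropHull {n : ℕ} (A : Matrix (Fin n) (Fin n) ℝ) : Set (TropTorus n) :=
  {p | ∃ c : Fin n → ℝ, p = TropTorus.mk fun k => ⨅ i, (c i + A k i)}

theorem col_mem_tropHull {n : ℕ} (A : Matrix (Fin n) (Fin n) ℝ) (i : Fin n) :
    TropTorus.mk (fun k => A k i) ∈ tropHull A := by
  have : Nonempty (Fin n) := ⟨i⟩
  refine ⟨fun j => ⨆ k, (A k i - A k j), congrArg _ (funext fun k => ?_)⟩
  refine le_antisymm (le_ciInf fun j => ?_) ?_
  · have := le_ciSup (Set.finite_range fun k => A k i - A k j).bddAbove k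
    linarith
  · refine (ciInf_le
      (Set.finite_range fun j => (⨆ k, (A k i - A k j)) + A k j).bddBelow i).trans ?_
    simp

/-- The `i`-th column of `A` as a point of the tropical convex hull. -/
noncomputable def colPoint {n : ℕ} (A : Matrix (Fin n) (Fin n) ℝ) (i : Fin n) : tropHull A :=
  ⟨TropTorus.mk fun k => A k i, col_mem_tropHull A i⟩

/-- The class of the lattice vector `e_S = ∑_{j ∈ S} e_j`. -/
noncomputable def latticeDir {n : ℕ} (S : Finset (Fin n)) : TropTorus n :=
  TropTorus.mk fun k => if k ∈ S then 1 else 0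

/-- An edge of the tropical convex hull emanates from `p` in the direction `e_S`, where
`∅ ≠ S ≠ {1, …, n}` (for a hull of dimension at most one, every edge direction is of this form). -/
def IsEdgeDirection {n : ℕ} (A : Matrix (Fin n) (Fin n) ℝ) (p : TropTorus n)
    (S : Finset (Fin n)) : Prop :=
  S.Nonempty ∧ S ≠ Finset.univ ∧
    ∃ ε : ℝ, 0 < ε ∧ ∀ t : ℝ, 0 ≤ t → t ≤ ε → p + t • latticeDir S ∈ tropHull A

open Classical in
/-- Attaching, for every `j`, an infinite ray of direction `e_j` to the tropical convex hull at the
point `ray j` makes it balanced: at every point of the hull the lattice directions of all emanating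
edges and rays sum up to zero modulo `(1, …, 1)`. -/
def IsBalancing {n : ℕ} (A : Matrix (Fin n) (Fin n) ℝ) (ray : Fin n → tropHull A) : Prop :=
  ∀ p : tropHull A,
    (∑ S with IsEdgeDirection A p S, latticeDir S) + (∑ j with ray j = p, latticeDir {j}) = 0

/-! ### Metric trees with labeled leaves

A metric tree with leaves `1, …, n, 1', …, n'` whose leaf edges are infinite (their lengths carry no
information) is given by the geometric realization `X` of the union of its internal vertices and
edges, a metric space, together with the map `leaf` sending each label to the point of `X` at which
its leaf edge is attached; `Sum.inl i` is the label `i` and `Sum.inr i` is the label `i'`. -/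

/-- The set of points between `x` and `y`; in a metric tree this is the path from `x` to `y`. -/
def treePath {X : Type*} [MetricSpace X] (x y : X) : Set X :=
  {z | dist x z + dist z y = dist x y}

/-- A metric tree (real tree): a geodesic metric space satisfying the four-point condition. -/
structure IsMetricTree (X : Type*) [MetricSpace X] : Prop where
  geodesic : ∀ x y : X, ∃ γ : ℝ → X, γ 0 = x ∧ γ (dist x y) = y ∧
    ∀ s ∈ Set.Icc 0 (dist x y), ∀ t ∈ Set.Icc 0 (dist x y), dist (γ s) (γ t) = |s - t|
  four_point : ∀ x y z w : X,
    dist x y + dist z w ≤ max (dist x z + dist y w) (dist x w + dist y z)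

/-- The labels on the side of `u` when the open path from `u` to `v` is removed. -/
def labelsBeyond {n : ℕ} {X : Type*} [MetricSpace X] (leaf : Fin n ⊕ Fin n → X) (u v : X) :
    Set (Fin n ⊕ Fin n) :=
  {s | u ∈ treePath (leaf s) v}

/-- The path from `u` to `v` is nondegenerate and lies in an internal edge: no leaf edge and no
further branch is attached at a point strictly between `u` and `v`, so every leaf lies beyond `u` or
beyond `v`. The sets of leaves beyond `u` and beyond `v` then form the split given by the edge. -/
def InInternalEdge {n : ℕ} {X : Type*} [MetricSpace X] (leaf : Fin n ⊕ Fin n → X) (u v : X) :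
    Prop :=
  u ≠ v ∧ ∀ s, s ∈ labelsBeyond leaf u v ∨ s ∈ labelsBeyond leaf v u

/-- A set of labels contains both colors. -/
def HasBothColors {n : ℕ} (L : Set (Fin n ⊕ Fin n)) : Prop :=
  (∃ i, Sum.inl i ∈ L) ∧ ∃ j, Sum.inr j ∈ L

/-- A bicolored tree: a metric tree, the union of the paths between its leaves, such that every
split has both colors on both sides. -/
structure IsBicoloredTree {n : ℕ} {X : Type*} [MetricSpace X] (leaf : Fin n ⊕ Fin n → X) :
    Prop where
  tree : IsMetricTree X
  spanned : ∀ x : X, ∃ s t, x ∈ treePath (leaf s) (leaf t)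
  bicolored : ∀ u v : X, InInternalEdge leaf u v →
    HasBothColors (labelsBeyond leaf u v) ∧ HasBothColors (labelsBeyond leaf v u)

/-- A symmetric bicolored tree (symbic tree): a bicolored tree with an isometric involution which
swaps the leaves `i` and `i'` for all `i` and whose fixed points form a path (possibly consisting of
a single point). Internal edges have positive length because `X` is a metric space. -/
structure IsSymbicTree {n : ℕ} {X : Type*} [MetricSpace X] (leaf : Fin n ⊕ Fin n → X) :
    Prop extends IsBicoloredTree leaf where
  symmetric : ∃ φ : X ≃ᵢ X, Function.Involutive φ ∧ (∀ s, φ (leaf s) = leaf s.swap) ∧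
    ∃ p q : X, Function.fixedPoints φ = treePath p q

/-- Isomorphism of metric trees with labeled leaves. -/
def LabeledTreeIso {n : ℕ} {X Y : Type*} [MetricSpace X] [MetricSpace Y]
    (leaf : Fin n ⊕ Fin n → X) (leaf' : Fin n ⊕ Fin n → Y) : Prop :=
  ∃ f : X ≃ᵢ Y, ∀ s, f (leaf s) = leaf' s

/-- The leaves of the tree of `A`: `i` is attached at the `i`-th column, and `j'` is attached at the
point where the ray of direction `e_j` is attached. -/
noncomputable def matrixTree {n : ℕ} (A : Matrix (Fin n) (Fin n) ℝ) (ray : Fin n → tropHull A) :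
    Fin n ⊕ Fin n → tropHull A :=
  Sum.elim (colPoint A) ray

/-- The labeled metric tree `leaf` is the tree associated with the matrix `A`. -/
def ArisesFrom {n : ℕ} {X : Type*} [MetricSpace X] (leaf : Fin n ⊕ Fin n → X)
    (A : Matrix (Fin n) (Fin n) ℝ) : Prop :=
  ∃ ray : Fin n → tropHull A, IsBalancing A ray ∧ LabeledTreeIso (matrixTree A ray) leaf

/-! ### Metric trees -/

section MetricTree

variable {X : Type*} [MetricSpace X]

/-! For symmetric `A`, a point of the hull is a pair `x`, `y` with `x_k + y_i ≤ A_{ki}`, tight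
somewhere in every row and every column (`DualPair`). Exchanging `x` and `y` is an isometric
involution of the hull, and the ray `e_j` has to be attached at the image of the `j`-th column
(`rayPoint`).

Write `s_{ki} = A_{ki} - x_k - y_i`. Rank two gives `s_{ki} ≥ min(s_{kj}, s_{lj}, s_{li})`
(`HasSymTropRank.slack_ultra`). Hence Gromov products based at `x` are ultrametric and the hull is a
tree. Column supports of `s` that meet must coincide, which gives the balancing
(`HasSymTropRank.isBalancing`). Every direction at a point leads to a column, and by duality to a
ray (`HasSymTropRank.exists_col_beyond`), which gives bicoloredness. The fixed points form a path
because of principal minors: their two `3`-cycles are the same monomial, so together they do not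
count as a minimum attained twice, and this rules out a tripod of fixed points
(`HasSymTropRank.no_tripod`).

Conversely, a symbic tree yields the matrix `-d(i, j')/2`. The four-point condition handles terms
whose monomial comes from a single permutation (`IsMetricTree.max_minor`), and the fixed path
handles the `3`-cycles of principal minors (`IsSymbicTree.principal_minor`). The distances to the
primed leaves embed the tree isometrically onto the hull. In the other direction the distances in
`T_A` determine `A` up to scaling (`HasSymTropRank.exists_eq_dist`). So `A` gives the tree exactly
when it is a rescaling of `-d/2` (`IsSymbicTree.arisesFrom_iff`), which settles existence and
uniqueness together. -/

theorem IsMetricTree.exists_dist_eq (h : IsMetricTree X) (x y : X) {a : ℝ} (ha : 0 ≤ a)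
    (ha' : a ≤ dist x y) : ∃ z, dist x z = a ∧ dist z y = dist x y - a := by
  obtain ⟨γ, h0, h1, hγ⟩ := h.geodesic x y
  refine ⟨γ a, ?_, ?_⟩
  · rw [← h0, hγ 0 ⟨le_rfl, dist_nonneg⟩ a ⟨ha, ha'⟩, zero_sub, abs_neg, abs_of_nonneg ha]
  · have := hγ a ⟨ha, ha'⟩ (dist x y) ⟨dist_nonneg, le_rfl⟩
    rw [h1] at this
    rw [this, abs_sub_comm, abs_of_nonneg (by linarith)]

/-- Both terms are lower bounds by the triangle inequality. The four-point condition makes one of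
them exact, according to the side of `z` on which `w` branches off. -/
theorem IsMetricTree.dist_of_mem_treePath (h : IsMetricTree X) {u v z : X} (hz : z ∈ treePath u v)
    (w : X) : dist z w = max (dist u w - dist u z) (dist v w - dist z v) := by
  have hz : dist u z + dist z v = dist u v := hz
  apply le_antisymm
  · have := h.four_point z w u v
    rw [dist_comm z u, dist_comm w v, dist_comm w u] at this
    rcases le_max_iff.1 this with h | h
    · exact le_max_of_le_right (by linarith)
    · exact le_max_of_le_left (by linarith)
  · have h1 := dist_triangle u z w
    have h2 := dist_triangle v z w
    rw [dist_comm v z] at h2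
    exact max_le (by linarith) (by linarith)

theorem IsMetricTree.eq_of_mem_treePath (h : IsMetricTree X) {u v z w : X} (hz : z ∈ treePath u v)
    (hw : w ∈ treePath u v) (hd : dist u z = dist u w) : z = w := by
  have h1 := h.dist_of_mem_treePath hz w
  have hz : dist u z + dist z v = dist u v := hz
  have hw : dist u w + dist w v = dist u v := hw
  have h2 : dist v w - dist z v = 0 := by rw [dist_comm v w]; linarith
  rw [hd, h2, sub_self, max_self] at h1
  exact dist_eq_zero.1 h1

theorem IsMetricTree.exists_midpoint (h : IsMetricTree X) (x y : X) :
    ∃ z, dist x z = dist x y / 2 ∧ dist z y = dist x y / 2 := by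
  obtain ⟨z, h1, h2⟩ := h.exists_dist_eq x y (a := dist x y / 2)
    (by positivity) (by linarith [dist_nonneg (x := x) (y := y)])
  exact ⟨z, h1, by linarith⟩

theorem IsMetricTree.midpoint_fixed (h : IsMetricTree X) {φ : X ≃ᵢ X}
    (hφ : Function.Involutive φ) {x z : X} (h1 : dist x z = dist x (φ x) / 2)
    (h2 : dist z (φ x) = dist x (φ x) / 2) : φ z = z := by
  have h3 : dist x (φ z) = dist x (φ x) / 2 := by
    rw [← hφ x, φ.dist_eq, hφ x, dist_comm, h2]
  have h4 : dist (φ z) (φ x) = dist x (φ x) / 2 := by rw [φ.dist_eq, dist_comm, h1]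
  refine (h.eq_of_mem_treePath (u := x) (v := φ x) (z := z) (w := φ z) ?_ ?_ (h1.trans h3.symm)).symm
  · show _ + _ = _
    linarith
  · show _ + _ = _
    linarith

theorem IsMetricTree.fixed_of_mem_treePath (h : IsMetricTree X) {φ : X ≃ᵢ X} {p q z : X}
    (hp : φ p = p) (hq : φ q = q) (hz : z ∈ treePath p q) : φ z = z := by
  have e1 : dist p (φ z) = dist p z := by conv_lhs => rw [← hp, φ.dist_eq]
  have e2 : dist (φ z) q = dist z q := by conv_lhs => rw [← hq, φ.dist_eq]
  refine h.eq_of_mem_treePath (u := p) (v := q) ?_ hz e1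
  have hz : dist p z + dist z q = dist p q := hz
  show _ + _ = _
  rw [e1, e2, hz]

theorem IsMetricTree.exists_median (h : IsMetricTree X) (u v w : X) :
    ∃ m, m ∈ treePath u v ∧ m ∈ treePath v w ∧ m ∈ treePath u w := by
  obtain ⟨m, h1, h2⟩ := h.exists_dist_eq u v (a := (dist u v + dist u w - dist v w) / 2)
    (by linarith [dist_triangle v u w, dist_comm u v])
    (by linarith [dist_triangle u v w])
  have hm : m ∈ treePath u v := by
    show _ + _ = _
    linarith
  have h3 := h.dist_of_mem_treePath hm w
  have h4 : dist u w - dist u m = dist v w - dist m v := by rw [h1, h2]; ring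
  rw [h4, max_self] at h3
  refine ⟨m, hm, ?_, ?_⟩
  · show dist v m + dist m w = dist v w
    rw [dist_comm v m]; linarith
  · show dist u m + dist m w = dist u w
    linarith

/-- The fixed points of an isometric involution of a compact metric tree form a path as soon as they
contain no tripod. -/
theorem IsMetricTree.fixedPoints_eq_treePath [CompactSpace X] [Nonempty X] (h : IsMetricTree X)
    {φ : X ≃ᵢ X} (hφ : Function.Involutive φ)
    (htri : ∀ m u v w : X, φ m = m → φ u = u → φ v = v → φ w = w → m ∈ treePath u v →
      m ∈ treePath v w → m ∈ treePath u w → m = u ∨ m = v ∨ m = w) :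
    ∃ p q : X, Function.fixedPoints φ = treePath p q := by
  have hcl : IsCompact (Function.fixedPoints φ) :=
    (isClosed_eq φ.continuous continuous_id).isCompact
  have hne : (Function.fixedPoints φ).Nonempty := by
    obtain ⟨x⟩ := ‹Nonempty X›
    obtain ⟨z, h1, h2⟩ := h.exists_midpoint x (φ x)
    exact ⟨z, h.midpoint_fixed hφ h1 h2⟩
  -- A farthest pair of fixed points serves as the two ends of the path.
  obtain ⟨⟨p, q⟩, ⟨hp, hq⟩, hmax⟩ := (hcl.prod hcl).exists_isMaxOn (hne.prod hne)
    (f := fun r : X × X => dist r.1 r.2) (by fun_prop)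
  have hp : φ p = p := hp
  have hq : φ q = q := hq
  refine ⟨p, q, Set.Subset.antisymm (fun z hz => ?_) fun z hz => h.fixed_of_mem_treePath hp hq hz⟩
  have hz : φ z = z := hz
  obtain ⟨m, h1, h2, h3⟩ := h.exists_median p q z
  have hzq : dist z q ≤ dist p q := hmax (show (z, q) ∈ _ from ⟨hz, hq⟩)
  have hpz : dist p z ≤ dist p q := hmax (show (p, z) ∈ _ from ⟨hp, hz⟩)
  have e1 : dist p m + dist m q = dist p q := h1
  have e2 : dist q m + dist m z = dist q z := h2
  have e3 : dist p m + dist m z = dist p z := h3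
  rw [dist_comm q m, dist_comm q z] at e2
  -- If the median is an end `p` or `q`, maximality of `dist p q` forces `z = m`; otherwise `z` is
  -- itself the median and lies on the path.
  rcases htri m p q z (h.fixed_of_mem_treePath hp hq h1) hp hq hz h1 h2 h3 with rfl | rfl | rfl
  · have : dist m z = 0 := le_antisymm (by linarith) dist_nonneg
    rwa [← dist_eq_zero.1 this]
  · have : dist m z = 0 := le_antisymm (by linarith) dist_nonneg
    rwa [← dist_eq_zero.1 this]
  · exact h1

end MetricTree

/-- In a bicolored tree both colors lie beyond `u` as seen from any other point `v`. -/
theorem IsBicoloredTree.hasBothColors {n : ℕ} {X : Type*} [MetricSpace X]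
    {leaf : Fin n ⊕ Fin n → X} (h : IsBicoloredTree leaf) {u v : X} (huv : u ≠ v) :
    HasBothColors (labelsBeyond leaf u v) := by
  have hD : 0 < dist u v := dist_pos.2 huv
  -- The path from `u` to a leaf leaves the path from `u` to `v` at distance `(d(u,s) + d(u,v) -
  -- d(v,s))/2` from `u`. The constant `ε` is at most each nonzero one of these finitely many
  -- distances.
  obtain ⟨ε, hε, hεD, hgap⟩ : ∃ ε : ℝ, 0 < ε ∧ ε ≤ dist u v ∧ ∀ s,
      dist v (leaf s) = dist u (leaf s) + dist u v ∨
      dist v (leaf s) ≤ dist u (leaf s) + dist u v - 2 * ε := by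
    obtain ⟨s₀, -⟩ := h.spanned u
    have : Nonempty (Fin n ⊕ Fin n) := ⟨s₀⟩
    set g : Fin n ⊕ Fin n → ℝ := fun s =>
      if dist v (leaf s) = dist u (leaf s) + dist u v then dist u v
      else min (dist u v) ((dist u (leaf s) + dist u v - dist v (leaf s)) / 2) with hg
    obtain ⟨s₁, hs₁⟩ := Finite.exists_min g
    have hpos : ∀ s, 0 < g s ∧ g s ≤ dist u v := by
      intro s
      simp only [hg]
      split_ifs with hs
      · exact ⟨hD, le_rfl⟩
      · have := lt_of_le_of_ne (dist_triangle v u (leaf s))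
          (by rw [dist_comm v u, add_comm]; exact hs)
        rw [dist_comm v u] at this
        exact ⟨lt_min hD (by linarith), min_le_left _ _⟩
    refine ⟨g s₁, (hpos s₁).1, (hpos s₁).2, fun s => ?_⟩
    by_cases hs : dist v (leaf s) = dist u (leaf s) + dist u v
    · exact Or.inl hs
    · right
      have h1 := hs₁ s
      have h2 : g s ≤ (dist u (leaf s) + dist u v - dist v (leaf s)) / 2 := by
        simp only [hg, if_neg hs]
        exact min_le_right _ _
      linarith
  obtain ⟨u', hu, hu'⟩ := h.tree.exists_dist_eq u v hε.le hεD
  have hmem : u' ∈ treePath u v := by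
    show _ + _ = _
    linarith
  have hd := fun s => h.tree.dist_of_mem_treePath hmem (leaf s)
  have hne : u ≠ u' := dist_pos.1 (by linarith)
  -- Nothing branches off strictly between `u` and `u'`, so the hypothesis on splits applies to this
  -- short segment.
  have hedge : InInternalEdge leaf u u' := by
    refine ⟨hne, fun s => ?_⟩
    rcases hgap s with hs | hs
    · left
      show dist (leaf s) u + dist u u' = dist (leaf s) u'
      rw [dist_comm (leaf s) u, dist_comm (leaf s) u', hd s, max_eq_right (by linarith)]
      linarith
    · right
      show dist (leaf s) u' + dist u' u = dist (leaf s) u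
      rw [dist_comm (leaf s) u, dist_comm (leaf s) u', hd s, max_eq_left (by linarith), dist_comm u' u]
      linarith
  have hsub : labelsBeyond leaf u u' ⊆ labelsBeyond leaf u v := by
    intro s hs
    have hs : dist (leaf s) u + dist u u' = dist (leaf s) u' := hs
    show dist (leaf s) u + dist u v = dist (leaf s) v
    rw [dist_comm (leaf s) u, dist_comm (leaf s) u', hd s] at hs
    rw [dist_comm (leaf s) u, dist_comm (leaf s) v]
    rcases max_cases (dist u (leaf s) - dist u u') (dist v (leaf s) - dist u' v) with h1 | h1 <;>
      linarith
  obtain ⟨⟨i, hi⟩, j, hj⟩ := (h.bicolored u u' hedge).1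
  exact ⟨⟨i, hsub hi⟩, j, hsub hj⟩

/-! ### Symmetric minors -/

section Minors

variable {n : ℕ}

/-- The exponent vector of the term of the minor with rows `r` and columns `c` given by `σ`. -/
noncomputable def permExponent (r c : Fin 3 → Fin n) (σ : Equiv.Perm (Fin 3)) :
    Fin n × Fin n →₀ ℕ :=
  ∑ a, Finsupp.single (min (r (σ a)) (c a), max (r (σ a)) (c a)) 1

/-- The value at `A` of the term of the minor with rows `r` and columns `c` given by `σ`. -/
noncomputable def permValue (A : Matrix (Fin n) (Fin n) ℝ) (r c : Fin 3 → Fin n)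
    (σ : Equiv.Perm (Fin 3)) : ℝ :=
  ∑ a, A (r (σ a)) (c a)

theorem tropMonomial_permExponent {A : Matrix (Fin n) (Fin n) ℝ} (hA : A.IsSymm)
    (r c : Fin 3 → Fin n) (σ : Equiv.Perm (Fin 3)) :
    tropMonomial A (permExponent r c σ) = permValue A r c σ := by
  unfold tropMonomial permExponent permValue
  simp only [Finsupp.finsetSum_apply, Nat.cast_sum, Finset.sum_mul]
  rw [Finset.sum_comm]
  refine Finset.sum_congr rfl fun a _ => ?_
  rw [Finset.sum_eq_single (min (r (σ a)) (c a), max (r (σ a)) (c a))]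
  · rw [Finsupp.single_eq_same, Nat.cast_one, one_mul]
    rcases le_total (r (σ a)) (c a) with h | h
    · simp [h]
    · simp only [h, min_eq_right, max_eq_left]
      exact hA.apply _ _
  · intro b _ hb
    rw [Finsupp.single_eq_of_ne hb]
    simp
  · simp

theorem coeff_symMinor (I J : Fin 3 ↪o Fin n) (m : Fin n × Fin n →₀ ℕ) :
    (symMinor I J).coeff m =
      ∑ σ, if permExponent I J σ = m then ((Equiv.Perm.sign σ : ℤ) : ℚ) else 0 := by
  unfold symMinor
  rw [Matrix.det_apply, MvPolynomial.coeff_sum]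
  refine Finset.sum_congr rfl fun σ _ => ?_
  have : (∏ i, (Matrix.of fun a b => (MvPolynomial.X (min (I a) (J b), max (I a) (J b)) :
      MvPolynomial (Fin n × Fin n) ℚ)) (σ i) i) = MvPolynomial.monomial (permExponent I J σ) 1 := by
    unfold permExponent
    rw [MvPolynomial.monomial_sum_one]
    rfl
  rw [this]
  rcases Int.units_eq_one_or (Equiv.Perm.sign σ) with h | h <;>
    simp [h, MvPolynomial.coeff_monomial, apply_ite]

theorem exists_term_of_permExponent_eq {r c : Fin 3 → Fin n} {σ τ : Equiv.Perm (Fin 3)}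
    (h : permExponent r c σ = permExponent r c τ) (a : Fin 3) :
    ∃ b, (r (σ a) = r (τ b) ∧ c a = c b) ∨ (r (σ a) = c b ∧ c a = r (τ b)) := by
  by_contra! hcon
  have h1 := DFunLike.congr_fun h (min (r (σ a)) (c a), max (r (σ a)) (c a))
  unfold permExponent at h1
  simp only [Finsupp.finsetSum_apply] at h1
  have h2 : ∑ b, (Finsupp.single (min (r (τ b)) (c b), max (r (τ b)) (c b)) 1 :
      Fin n × Fin n →₀ ℕ) (min (r (σ a)) (c a), max (r (σ a)) (c a)) = 0 := by
    refine Finset.sum_eq_zero fun b _ => Finsupp.single_eq_of_ne fun hb => ?_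
    obtain ⟨e1, e2⟩ := Prod.ext_iff.1 hb
    simp only at e1 e2
    have := hcon b
    grind
  rw [h2] at h1
  have h3 := Finset.sum_eq_zero_iff.1 h1 a (Finset.mem_univ a)
  simp at h3

theorem perm_three_cases (σ τ : Equiv.Perm (Fin 3)) (h : σ ≠ τ) :
    (∃ a b d : Fin 3, a ≠ b ∧ a ≠ d ∧ b ≠ d ∧ σ a = τ a ∧ σ b = τ d ∧ σ d = τ b) ∨
    ((∀ a, σ a ≠ τ a) ∧ Equiv.Perm.sign σ = Equiv.Perm.sign τ) := by
  revert σ τ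
  decide

/-- If the two permutations differed by transposing `b` and `d`, equality of the monomials would
force `c a` to equal both `r (σ b)` and `r (σ d)`. So they differ by a `3`-cycle, which is even. -/
theorem forall_ne_of_permExponent_eq {r c : Fin 3 → Fin n} (hr : Function.Injective r)
    (hc : Function.Injective c) {σ τ : Equiv.Perm (Fin 3)}
    (h : permExponent r c σ = permExponent r c τ) (hne : σ ≠ τ) :
    (∀ a, σ a ≠ τ a) ∧ Equiv.Perm.sign σ = Equiv.Perm.sign τ := by
  refine (perm_three_cases σ τ hne).resolve_left ?_
  rintro ⟨a, b, d, hab, had, hbd, h1, h2, h3⟩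
  have key : ∀ b d, a ≠ b → a ≠ d → b ≠ d → σ b = τ d → σ d = τ b →
      c a = r (σ b) := by
    intro b d hab had hbd h2 h3
    obtain ⟨x, hx⟩ := exists_term_of_permExponent_eq h b
    have hx' : x = a ∨ x = b ∨ x = d := by omega
    rcases hx with ⟨e1, e2⟩ | ⟨e1, e2⟩
    · have e2 := hc e2
      have e1 := hr e1
      rw [← e2, h2] at e1
      exact absurd (τ.injective e1) hbd.symm
    · rcases hx' with rfl | rfl | rfl
      · exact e1.symm
      · exact absurd (σ.injective (hr ((e1.trans e2).trans (congrArg r h3.symm)))) hbd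
      · rw [← h2, e1] at e2
        exact absurd (hc e2) hbd
  have e1 := key b d hab had hbd h2 h3
  have e2 := key d b had hab hbd.symm h3 h2
  exact hbd (σ.injective (hr (e1.symm.trans e2)))

/-- Terms with the same monomial have the same sign, so nothing cancels in the determinant. -/
theorem permExponent_mem_support (I J : Fin 3 ↪o Fin n) (σ : Equiv.Perm (Fin 3)) :
    permExponent I J σ ∈ (symMinor I J).support := by
  classical
  rw [MvPolynomial.mem_support_iff, coeff_symMinor, ← Finset.sum_filter]
  have : ∀ τ ∈ Finset.univ.filter (fun τ => permExponent I J τ = permExponent I J σ),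
      ((Equiv.Perm.sign τ : ℤ) : ℚ) = ((Equiv.Perm.sign σ : ℤ) : ℚ) := by
    intro τ hτ
    by_cases hne : τ = σ
    · rw [hne]
    · rw [(forall_ne_of_permExponent_eq I.injective J.injective (Finset.mem_filter.1 hτ).2 hne).2]
  rw [Finset.sum_congr rfl this, Finset.sum_const, nsmul_eq_mul]
  refine mul_ne_zero ?_ ?_
  · rw [Nat.cast_ne_zero]
    exact (Finset.card_pos.2 ⟨σ, by simp⟩).ne'
  · rcases Int.units_eq_one_or (Equiv.Perm.sign σ) with h | h <;> simp [h]

theorem exists_perm_of_mem_support {I J : Fin 3 ↪o Fin n} {m : Fin n × Fin n →₀ ℕ}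
    (hm : m ∈ (symMinor I J).support) : ∃ σ, permExponent I J σ = m := by
  rw [MvPolynomial.mem_support_iff, coeff_symMinor] at hm
  obtain ⟨σ, -, hσ⟩ := Finset.exists_ne_zero_of_sum_ne_zero hm
  exact ⟨σ, by by_contra h; simp [h] at hσ⟩

theorem minAttainedTwice_iff {A : Matrix (Fin n) (Fin n) ℝ} (hA : A.IsSymm)
    (I J : Fin 3 ↪o Fin n) : MinAttainedTwice A (symMinor I J) ↔
      ∀ σ, ∃ τ, permExponent I J τ ≠ permExponent I J σ ∧
        permValue A I J τ ≤ permValue A I J σ := by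
  constructor
  · rintro ⟨m₁, h₁, m₂, h₂, hne, hm₁, hm₂⟩ σ
    obtain ⟨τ₁, rfl⟩ := exists_perm_of_mem_support h₁
    obtain ⟨τ₂, rfl⟩ := exists_perm_of_mem_support h₂
    have e₁ := hm₁ _ (permExponent_mem_support I J σ)
    have e₂ := hm₂ _ (permExponent_mem_support I J σ)
    rw [tropMonomial_permExponent hA, tropMonomial_permExponent hA] at e₁ e₂
    by_cases h : permExponent I J τ₁ = permExponent I J σ
    · exact ⟨τ₂, fun h' => hne (h.trans h'.symm), e₂⟩
    · exact ⟨τ₁, h, e₁⟩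
  · intro h
    obtain ⟨σ, hσ⟩ := Finite.exists_min (permValue A I J)
    obtain ⟨τ, hne, hτ⟩ := h σ
    have key : ∀ ρ, permValue A I J ρ ≤ permValue A I J σ → ∀ m ∈ (symMinor I J).support,
        tropMonomial A (permExponent I J ρ) ≤ tropMonomial A m := by
      intro ρ hρ m hm
      obtain ⟨π, rfl⟩ := exists_perm_of_mem_support hm
      rw [tropMonomial_permExponent hA, tropMonomial_permExponent hA]
      exact hρ.trans (hσ π)
    exact ⟨_, permExponent_mem_support I J τ, _, permExponent_mem_support I J σ, hne,
      key τ hτ, key σ le_rfl⟩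

theorem exists_orderEmbedding_comp {r : Fin 3 → Fin n} (hr : Function.Injective r) :
    ∃ (I : Fin 3 ↪o Fin n) (π : Equiv.Perm (Fin 3)), ∀ a, r a = I (π a) := by
  have hmono : StrictMono (r ∘ Tuple.sort r) :=
    (Tuple.monotone_sort r).strictMono_of_injective (hr.comp (Tuple.sort r).injective)
  exact ⟨OrderEmbedding.ofStrictMono _ hmono, (Tuple.sort r)⁻¹, fun a => by simp⟩

/-- Sorting the rows and columns only relabels the permutations, so the rank condition may be used
for arbitrarily ordered index lists. -/
theorem HasSymTropRank.exists_perm {A : Matrix (Fin n) (Fin n) ℝ} (h : HasSymTropRank 2 A)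
    {r c : Fin 3 → Fin n} (hr : Function.Injective r) (hc : Function.Injective c)
    (σ : Equiv.Perm (Fin 3)) : ∃ τ, permExponent r c τ ≠ permExponent r c σ ∧
      permValue A r c τ ≤ permValue A r c σ := by
  obtain ⟨I, π, hI⟩ := exists_orderEmbedding_comp hr
  obtain ⟨J, ρ, hJ⟩ := exists_orderEmbedding_comp hc
  have e1 : ∀ τ, permExponent r c τ = permExponent I J (π * τ * ρ⁻¹) := fun τ => by
    unfold permExponent
    refine Fintype.sum_equiv ρ _ _ fun a => ?_
    simp [hI, hJ]
  have e2 : ∀ τ, permValue A r c τ = permValue A I J (π * τ * ρ⁻¹) := fun τ => by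
    unfold permValue
    refine Fintype.sum_equiv ρ _ _ fun a => ?_
    simp [hI, hJ]
  obtain ⟨τ, h1, h2⟩ := (minAttainedTwice_iff h.1 I J).1 (h.2 I J) (π * σ * ρ⁻¹)
  refine ⟨π⁻¹ * τ * ρ, ?_, ?_⟩
  · rw [e1, e1]
    convert h1 using 2
    group
  · rw [e2, e2]
    convert h2 using 2
    group

theorem perm_three_apply (τ : Equiv.Perm (Fin 3)) :
    (τ 0 = 0 ∧ τ 1 = 1 ∧ τ 2 = 2) ∨ (τ 0 = 0 ∧ τ 1 = 2 ∧ τ 2 = 1) ∨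
    (τ 0 = 1 ∧ τ 1 = 0 ∧ τ 2 = 2) ∨ (τ 0 = 1 ∧ τ 1 = 2 ∧ τ 2 = 0) ∨
    (τ 0 = 2 ∧ τ 1 = 0 ∧ τ 2 = 1) ∨ (τ 0 = 2 ∧ τ 1 = 1 ∧ τ 2 = 0) := by
  revert τ
  decide

theorem vec_three_injective {α : Type*} {k l p : α} (hkl : k ≠ l) (hkp : k ≠ p) (hlp : l ≠ p) :
    Function.Injective ![k, l, p] := by
  intro a b h
  fin_cases a <;> fin_cases b <;> simp_all

/-- No term of a `3 × 3` minor is strictly smaller than the five others. -/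
theorem HasSymTropRank.minor {A : Matrix (Fin n) (Fin n) ℝ} (h : HasSymTropRank 2 A)
    {k l p i j m : Fin n} (hkl : k ≠ l) (hkp : k ≠ p) (hlp : l ≠ p) (hij : i ≠ j) (him : i ≠ m)
    (hjm : j ≠ m) :
    A k i + A p j + A l m ≤ A k i + A l j + A p m ∨ A l i + A k j + A p m ≤ A k i + A l j + A p m ∨
    A l i + A p j + A k m ≤ A k i + A l j + A p m ∨ A p i + A k j + A l m ≤ A k i + A l j + A p m ∨
    A p i + A l j + A k m ≤ A k i + A l j + A p m := by
  obtain ⟨τ, h1, h2⟩ := h.exists_perm (vec_three_injective hkl hkp hlp)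
    (vec_three_injective hij him hjm) 1
  unfold permValue at h2
  rcases perm_three_apply τ with h | h | h | h | h | h
  · exact absurd (congrArg _ (Equiv.ext fun a => by fin_cases a <;> simp [h])) h1
  all_goals simp [Fin.sum_univ_three, h] at h2; simp [h2]

/-- In a principal `3 × 3` minor the term of the `3`-cycles is not strictly the smallest one. -/
theorem HasSymTropRank.principal_minor {A : Matrix (Fin n) (Fin n) ℝ} (h : HasSymTropRank 2 A)
    {i j k : Fin n} (hij : i ≠ j) (hik : i ≠ k) (hjk : j ≠ k) :
    A i i + A j j + A k k ≤ A i j + A j k + A i k ∨ A i i + A j k ≤ A i j + A i k ∨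
    A j j + A i k ≤ A i j + A j k ∨ A k k + A i j ≤ A i k + A j k := by
  have hinj := vec_three_injective hij hik hjk
  obtain ⟨τ, h1, h2⟩ := h.exists_perm hinj hinj (finRotate 3)
  have s1 := h.1.apply i j
  have s2 := h.1.apply i k
  have s3 := h.1.apply j k
  unfold permValue at h2
  have r0 : finRotate 3 0 = 1 := by decide
  have r1 : finRotate 3 1 = 2 := by decide
  have r2 : finRotate 3 2 = 0 := by decide
  rcases perm_three_apply τ with h | h | h | h | h | h
  · simp [Fin.sum_univ_three, h] at h2
    left; linarith
  · simp [Fin.sum_univ_three, h] at h2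
    right; left; linarith
  · simp [Fin.sum_univ_three, h] at h2
    right; right; right; linarith
  · refine absurd (congrArg _ (Equiv.ext fun a => ?_)) h1
    fin_cases a <;> simp [h, r0, r1, r2]
  -- The inverse `3`-cycle has the same monomial because `x_{ij} = x_{ji}`, so it is excluded as
  -- well.
  · refine absurd ?_ h1
    unfold permExponent
    simp only [Fin.sum_univ_three, h, r0, r1, r2]
    simp [min_comm, max_comm]
    abel
  · simp [Fin.sum_univ_three, h] at h2
    right; right; left; linarith

end Minors

/-! ### The tropical convex hull of a symmetric matrix and its duality -/

section Hull

variable {n : ℕ} [NeZero n]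

theorem hilbertDist_eq_sub {u w : Fin n → ℝ} {a b : ℝ} (h : ∀ k, a ≤ u k - w k ∧ u k - w k ≤ b)
    (ha : ∃ k, u k - w k = a) (hb : ∃ k, u k - w k = b) : hilbertDist u w = b - a := by
  obtain ⟨k, hk⟩ := ha
  obtain ⟨l, hl⟩ := hb
  refine le_antisymm (hilbertDist_le_iff.2 fun i j => ?_) ?_
  · linarith [(h i).2, (h j).1]
  · have := hilbertDist_le_iff.1 (le_refl (hilbertDist u w)) l k
    linarith

omit [NeZero n] in
theorem iInf_fin_le (f : Fin n → ℝ) (i : Fin n) : ⨅ j, f j ≤ f i :=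
  ciInf_le (Set.finite_range f).bddBelow i

omit [NeZero n] in
theorem le_iSup_fin (f : Fin n → ℝ) (i : Fin n) : f i ≤ ⨆ j, f j :=
  le_ciSup (Set.finite_range f).bddAbove i

theorem iInf_fin_eq {f : Fin n → ℝ} {a : ℝ} (h : ∀ i, a ≤ f i) (h' : ∃ i, f i = a) :
    ⨅ i, f i = a := by
  obtain ⟨i, hi⟩ := h'
  exact le_antisymm (hi ▸ iInf_fin_le f i) (le_ciInf h)

theorem iSup_fin_eq {f : Fin n → ℝ} {a : ℝ} (h : ∀ i, f i ≤ a) (h' : ∃ i, f i = a) :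
    ⨆ i, f i = a := by
  obtain ⟨i, hi⟩ := h'
  exact le_antisymm (ciSup_le h) (hi ▸ le_iSup_fin f i)

/-- The vector with entries `min_k (A_{ik} - x_k)`. -/
noncomputable def tropDual (A : Matrix (Fin n) (Fin n) ℝ) (x : Fin n → ℝ) : Fin n → ℝ :=
  fun i => ⨅ k, (A i k - x k)

omit [NeZero n] in
theorem tropDual_le (A : Matrix (Fin n) (Fin n) ℝ) (x : Fin n → ℝ) (i k : Fin n) :
    tropDual A x i ≤ A i k - x k :=
  iInf_fin_le (fun k => A i k - x k) k

theorem exists_eq_tropDual (A : Matrix (Fin n) (Fin n) ℝ) (x : Fin n → ℝ) (i : Fin n) :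
    ∃ k, A i k - x k = tropDual A x i :=
  exists_eq_ciInf_of_finite

/-- The vectors `x` and `y` satisfy `x_k + y_i ≤ A_{ki}` with equality somewhere in every row and
in every column. -/
structure DualPair (A : Matrix (Fin n) (Fin n) ℝ) (x y : Fin n → ℝ) : Prop where
  le : ∀ k i, x k + y i ≤ A k i
  row : ∀ k, ∃ i, x k + y i = A k i
  col : ∀ i, ∃ k, x k + y i = A k i

variable {A : Matrix (Fin n) (Fin n) ℝ} {x y : Fin n → ℝ}

omit [NeZero n] in
theorem DualPair.symm (h : DualPair A x y) (hA : A.IsSymm) : DualPair A y x where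
  le k i := by rw [add_comm, ← hA.apply]; exact h.le i k
  row k := by
    obtain ⟨i, hi⟩ := h.col k
    exact ⟨i, by rw [add_comm, hi, hA.apply]⟩
  col i := by
    obtain ⟨k, hk⟩ := h.row i
    exact ⟨k, by rw [add_comm, hk, hA.apply]⟩

theorem DualPair.tropDual_eq (h : DualPair A x y) (hA : A.IsSymm) : tropDual A x = y := by
  funext i
  refine iInf_fin_eq (fun k => ?_) ?_
  · have := h.le k i
    rw [hA.apply k i]; linarith
  · obtain ⟨k, hk⟩ := h.col i
    exact ⟨k, by rw [hA.apply k i]; linarith⟩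

/-- Any row-tight `z` suffices: `tropDual A x` is the largest admissible partner of `x`, so it keeps
the tight rows, and being a minimum it is tight in every column. -/
theorem dualPair_of_tight (hA : A.IsSymm) {z : Fin n → ℝ} (h : ∀ k i, x k + z i ≤ A k i)
    (h' : ∀ k, ∃ i, x k + z i = A k i) : DualPair A x (tropDual A x) where
  le k i := by
    have := tropDual_le A x i k
    rw [hA.apply k i] at this; linarith
  row k := by
    obtain ⟨i, hi⟩ := h' k
    obtain ⟨l, hl⟩ := exists_eq_tropDual A x i
    have h1 := tropDual_le A x i k
    have h2 := h l i
    rw [hA.apply l i] at hl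
    rw [hA.apply k i] at h1
    exact ⟨i, by linarith⟩
  col i := by
    obtain ⟨k, hk⟩ := exists_eq_tropDual A x i
    rw [hA.apply k i] at hk
    exact ⟨k, by linarith⟩

omit [NeZero n] in
theorem DualPair.add_const (h : DualPair A x y) (a : ℝ) :
    DualPair A (fun k => a + x k) (fun i => y i - a) where
  le k i := by linarith [h.le k i]
  row k := (h.row k).imp fun i hi => by linarith
  col i := (h.col i).imp fun k hk => by linarith

theorem mk_mem_tropHull_of_tight {z : Fin n → ℝ} (h : ∀ k i, x k + z i ≤ A k i)
    (h' : ∀ k, ∃ i, x k + z i = A k i) : TropTorus.mk x ∈ tropHull A := by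
  refine ⟨fun i => -z i, congrArg _ (funext fun k => (iInf_fin_eq (fun i => ?_) ?_).symm)⟩
  · linarith [h k i]
  · exact (h' k).imp fun i hi => by linarith

theorem DualPair.mem (h : DualPair A x y) : TropTorus.mk x ∈ tropHull A :=
  mk_mem_tropHull_of_tight h.le h.row

theorem dualPair_of_mk_mem (hA : A.IsSymm) (h : TropTorus.mk x ∈ tropHull A) :
    DualPair A x (tropDual A x) := by
  obtain ⟨c, hc⟩ := h
  obtain ⟨a, ha⟩ := TropTorus.mk_eq_mk.1 hc
  refine dualPair_of_tight hA (z := fun i => -c i - a) (fun k i => ?_) fun k => ?_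
  · have := iInf_fin_le (fun i => c i + A k i) i
    rw [ha]; linarith
  · obtain ⟨i, hi⟩ := exists_eq_ciInf_of_finite (f := fun i => c i + A k i)
    exact ⟨i, by rw [ha]; linarith⟩

theorem exists_dualPair (hA : A.IsSymm) {p : TropTorus n} (h : p ∈ tropHull A) :
    ∃ x y, DualPair A x y ∧ p = TropTorus.mk x := by
  obtain ⟨x, rfl⟩ := TropTorus.mk_surjective p
  exact ⟨x, _, dualPair_of_mk_mem hA h, rfl⟩

omit [NeZero n] in
theorem mk_add_const (a : ℝ) (x : Fin n → ℝ) :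
    TropTorus.mk (fun k => a + x k) = TropTorus.mk x :=
  TropTorus.mk_eq_mk.2 ⟨a, fun _ => rfl⟩

/-- The duality of the tropical convex hull of the columns of a symmetric matrix. -/
noncomputable def hullDual (A : Matrix (Fin n) (Fin n) ℝ) (p : TropTorus n) : TropTorus n :=
  TropTorus.mk (tropDual A (Function.surjInv TropTorus.mk_surjective p))

theorem hilbertDist_tropDual_le (A : Matrix (Fin n) (Fin n) ℝ) (x x' : Fin n → ℝ) :
    hilbertDist (tropDual A x) (tropDual A x') ≤ hilbertDist x x' := by
  refine hilbertDist_le_iff.2 fun i j => ?_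
  obtain ⟨k, hk⟩ := exists_eq_tropDual A x' i
  obtain ⟨l, hl⟩ := exists_eq_tropDual A x j
  have := hilbertDist_le_iff.1 (le_refl (hilbertDist x x')) l k
  linarith [tropDual_le A x i k, tropDual_le A x' j l]

theorem hullDual_mk (A : Matrix (Fin n) (Fin n) ℝ) (x : Fin n → ℝ) :
    hullDual A (TropTorus.mk x) = TropTorus.mk (tropDual A x) := by
  refine mk_eq_of_hilbertDist_eq_zero (le_antisymm ((hilbertDist_tropDual_le A _ _).trans ?_)
    (by rw [← TropTorus.dist_mk]; exact dist_nonneg))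
  rw [← TropTorus.dist_mk, Function.surjInv_eq TropTorus.mk_surjective, dist_self]

theorem DualPair.hullDual_eq (h : DualPair A x y) (hA : A.IsSymm) :
    hullDual A (TropTorus.mk x) = TropTorus.mk y := by
  rw [hullDual_mk, h.tropDual_eq hA]

theorem hullDual_mem (hA : A.IsSymm) {p : TropTorus n} (h : p ∈ tropHull A) :
    hullDual A p ∈ tropHull A := by
  obtain ⟨x, y, hxy, rfl⟩ := exists_dualPair hA h
  rw [hxy.hullDual_eq hA]
  exact (hxy.symm hA).mem

theorem hullDual_hullDual (hA : A.IsSymm) {p : TropTorus n} (h : p ∈ tropHull A) :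
    hullDual A (hullDual A p) = p := by
  obtain ⟨x, y, hxy, rfl⟩ := exists_dualPair hA h
  rw [hxy.hullDual_eq hA, (hxy.symm hA).hullDual_eq hA]

theorem dist_hullDual_le (A : Matrix (Fin n) (Fin n) ℝ) (p q : TropTorus n) :
    dist (hullDual A p) (hullDual A q) ≤ dist p q := by
  obtain ⟨x, rfl⟩ := TropTorus.mk_surjective p
  obtain ⟨x', rfl⟩ := TropTorus.mk_surjective q
  rw [hullDual_mk, hullDual_mk]
  exact hilbertDist_tropDual_le A x x'

/-- The duality as an isometric involution of the tropical convex hull. -/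
noncomputable def hullInvolution (hA : A.IsSymm) : tropHull A ≃ᵢ tropHull A where
  toFun p := ⟨hullDual A p, hullDual_mem hA p.2⟩
  invFun p := ⟨hullDual A p, hullDual_mem hA p.2⟩
  left_inv p := Subtype.ext (hullDual_hullDual hA p.2)
  right_inv p := Subtype.ext (hullDual_hullDual hA p.2)
  -- A nonexpansive involution is an isometry.
  isometry_toFun := Isometry.of_dist_eq fun p q => le_antisymm (dist_hullDual_le A p q) (by
    have := dist_hullDual_le A (hullDual A p) (hullDual A q)
    rwa [hullDual_hullDual hA p.2, hullDual_hullDual hA q.2] at this)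

theorem hullInvolution_involutive (hA : A.IsSymm) : Function.Involutive (hullInvolution hA) :=
  (hullInvolution hA).left_inv

/-- The point of the tropical convex hull dual to the `j`-th column. -/
noncomputable def rayPoint (hA : A.IsSymm) (j : Fin n) : tropHull A :=
  hullInvolution hA (colPoint A j)

/-! ### Slack vectors -/

/-- A nonnegative vector which vanishes somewhere. -/
def IsSlackVec (f : Fin n → ℝ) : Prop :=
  (∀ k, 0 ≤ f k) ∧ ∃ k, f k = 0

/-- The entry `f k` is at least the minimum of `g k`, `g l`, `f l`. -/
def UltraRel (f g : Fin n → ℝ) : Prop :=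
  ∀ k l, g k ≤ f k ∨ g l ≤ f k ∨ f l ≤ f k

/-- The Gromov product of two slack vectors with respect to the origin. -/
noncomputable def slackProd (f g : Fin n → ℝ) : ℝ :=
  ⨆ k, min (f k) (g k)

omit [NeZero n] in
theorem slackProd_comm (f g : Fin n → ℝ) : slackProd f g = slackProd g f := by
  simp only [slackProd, min_comm]

theorem exists_eq_slackProd (f g : Fin n → ℝ) : ∃ k, min (f k) (g k) = slackProd f g :=
  exists_eq_ciSup_of_finite

omit [NeZero n] in
theorem le_slackProd (f g : Fin n → ℝ) (k : Fin n) : min (f k) (g k) ≤ slackProd f g :=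
  le_iSup_fin (fun k => min (f k) (g k)) k

theorem UltraRel.sub_le {f g : Fin n → ℝ} (h : UltraRel g f) (k : Fin n) :
    f k - g k ≤ (⨆ l, f l) - slackProd f g := by
  obtain ⟨l, hl⟩ := exists_eq_slackProd f g
  have h1 := le_iSup_fin f k
  have h2 := le_iSup_fin f l
  have h3 := min_le_left (f l) (g l)
  have h4 := min_le_right (f l) (g l)
  rcases h k l with h | h | h <;> linarith

theorem exists_sub_eq {f g : Fin n → ℝ} (hg : IsSlackVec g) (hf : IsSlackVec f) :
    ∃ k, (⨆ l, f l) - slackProd f g ≤ f k - g k := by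
  obtain ⟨i, hi⟩ := exists_eq_ciSup_of_finite (f := f)
  rcases min_le_iff.1 (le_slackProd f g i) with h | h
  · obtain ⟨k, hk⟩ := hg.2
    exact ⟨k, by linarith [hf.1 k]⟩
  · exact ⟨i, by linarith⟩

/-- The maximum of `f - g` is `max f` minus the product, and that of `g - f` is `max g` minus the
product; the distance is their sum. -/
theorem hilbertDist_slack {f g : Fin n → ℝ} (hf : IsSlackVec f) (hg : IsSlackVec g)
    (hfg : UltraRel f g) (hgf : UltraRel g f) :
    hilbertDist f g = (⨆ k, f k) + (⨆ k, g k) - 2 * slackProd f g := by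
  refine le_antisymm (hilbertDist_le_iff.2 fun i j => ?_) ?_
  · have h1 := hgf.sub_le i
    have h2 := hfg.sub_le j
    rw [slackProd_comm g f] at h2
    linarith
  · obtain ⟨i, hi⟩ := exists_sub_eq hg hf
    obtain ⟨j, hj⟩ := exists_sub_eq hf hg
    rw [slackProd_comm g f] at hj
    have := hilbertDist_le_iff.1 (le_refl (hilbertDist f g)) i j
    linarith

/-- This is the ultrametric inequality for Gromov products, equivalent to the four-point condition
with one point at the base. It is tested at the indices where the two products on the left are
attained. -/
theorem slackProd_ultra {f g h : Fin n → ℝ} (hgh : UltraRel g h) :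
    min (slackProd f h) (slackProd h g) ≤ slackProd f g := by
  obtain ⟨k, hk⟩ := exists_eq_slackProd f h
  obtain ⟨l, hl⟩ := exists_eq_slackProd h g
  refine le_trans ?_ (le_slackProd f g k)
  rw [← hk, ← hl]
  refine le_min ((min_le_left _ _).trans (min_le_left _ _)) ?_
  rcases hgh k l with e | e | e
  · exact (min_le_left _ _).trans ((min_le_right _ _).trans e)
  · exact (min_le_right _ _).trans ((min_le_left _ _).trans e)
  · exact (min_le_right _ _).trans ((min_le_right _ _).trans e)

/-- The vector `x + f` represents a point of the tropical convex hull and `f` is a slack vector. -/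
structure IsAbove (A : Matrix (Fin n) (Fin n) ℝ) (x f : Fin n → ℝ) : Prop where
  slack : IsSlackVec f
  mem : TropTorus.mk (x + f) ∈ tropHull A

theorem exists_isAbove (x : Fin n → ℝ) {p : TropTorus n} (hp : p ∈ tropHull A) :
    ∃ f, IsAbove A x f ∧ p = TropTorus.mk (x + f) := by
  obtain ⟨u, rfl⟩ := TropTorus.mk_surjective p
  obtain ⟨k, hk⟩ := exists_eq_ciInf_of_finite (f := fun k => u k - x k)
  have h : TropTorus.mk (x + fun l => u l - x l - (u k - x k)) = TropTorus.mk u :=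
    TropTorus.mk_eq_mk.2 ⟨-(u k - x k), fun i => by simp; ring⟩
  refine ⟨fun l => u l - x l - (u k - x k), ⟨⟨fun l => ?_, k, sub_self _⟩, h ▸ hp⟩, h.symm⟩
  have := iInf_fin_le (fun k => u k - x k) l
  linarith

omit [NeZero n] in
theorem hilbertDist_add_left (x f g : Fin n → ℝ) :
    hilbertDist (x + f) (x + g) = hilbertDist f g := by
  simp [hilbertDist]

theorem dist_mk_add {f : Fin n → ℝ} (hf : IsSlackVec f) (x : Fin n → ℝ) :
    dist (TropTorus.mk x) (TropTorus.mk (x + f)) = ⨆ k, f k := by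
  rw [dist_comm, TropTorus.dist_mk]
  refine (hilbertDist_eq_sub (a := 0) (b := ⨆ k, f k) (fun k => ?_) ?_ ?_).trans (sub_zero _)
  · simpa using ⟨hf.1 k, le_iSup_fin f k⟩
  · simpa using hf.2
  · simpa using exists_eq_ciSup_of_finite (f := f)

omit [NeZero n] in
-- Complete `k, l` and `i, j` by a column `m` tight in row `l` and a row `p` tight in column `j`. In
-- the resulting minor the term `(k,i), (l,m), (p,j)` has total slack `s_{ki}`, and each of the
-- other five terms uses one of `(k,j), (l,j), (l,i)`. If these three all had larger slack, the
-- minimum would be attained only once.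
theorem HasSymTropRank.slack_ultra (hA : HasSymTropRank 2 A) (h : DualPair A x y)
    (k l i j : Fin n) :
    A k j - x k - y j ≤ A k i - x k - y i ∨ A l j - x l - y j ≤ A k i - x k - y i ∨
      A l i - x l - y i ≤ A k i - x k - y i := by
  by_contra! hcon
  obtain ⟨h1, h2, h3⟩ := hcon
  obtain ⟨m, hm⟩ := h.row l
  obtain ⟨p, hp⟩ := h.col j
  have h0 := h.le k i
  have e1 := h.le p m
  have e2 := h.le k m
  have e3 := h.le p i
  have hkl : k ≠ l := by rintro rfl; linarith
  have hij : i ≠ j := by rintro rfl; linarith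
  have hkp : k ≠ p := by rintro rfl; linarith
  have hlp : l ≠ p := by rintro rfl; linarith
  have him : i ≠ m := by rintro rfl; linarith
  have hjm : j ≠ m := by rintro rfl; linarith
  have := hA.minor hkl hkp hlp him hij hjm.symm
  rcases this with h | h | h | h | h <;> linarith

/-- Transfers `slack_ultra` to `f` and `g`: a column `i` tight for `x + f` in row `k` satisfies
`s_{ki} ≤ f k`, and a column `j` tight for `x + g` in a row where `g` vanishes has slack at least
`g` everywhere. -/
theorem IsAbove.ultraRel (hA : HasSymTropRank 2 A) (h : DualPair A x y) {f g : Fin n → ℝ}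
    (hf : IsAbove A x f) (hg : IsAbove A x g) : UltraRel f g := by
  intro k l
  have hu := dualPair_of_mk_mem hA.1 hf.mem
  have hv := dualPair_of_mk_mem hA.1 hg.mem
  set u := tropDual A (x + f)
  set v := tropDual A (x + g)
  obtain ⟨i, hi⟩ := hu.row k
  obtain ⟨m, hm⟩ := hg.slack.2
  obtain ⟨j, hj⟩ := hv.row m
  obtain ⟨q, hq⟩ := h.col i
  have e1 := hu.le l i
  have e2 := hu.le q i
  have e3 := hv.le k j
  have e4 := hv.le l j
  have e5 := h.le m j
  have e6 := hf.slack.1 q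
  simp only [Pi.add_apply] at *
  rcases hA.slack_ultra h k l i j with h | h | h
  · left; linarith
  · right; left; linarith
  · right; right; linarith

theorem IsAbove.dist_eq (hA : HasSymTropRank 2 A) (h : DualPair A x y) {f g : Fin n → ℝ}
    (hf : IsAbove A x f) (hg : IsAbove A x g) :
    dist (TropTorus.mk (x + f)) (TropTorus.mk (x + g)) =
      (⨆ k, f k) + (⨆ k, g k) - 2 * slackProd f g := by
  rw [TropTorus.dist_mk, hilbertDist_add_left,
    hilbertDist_slack hf.slack hg.slack (hf.ultraRel hA h hg) (hg.ultraRel hA h hf)]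

/-! ### The tropical convex hull is a metric tree -/

/-- The entrywise maximum of the dual vectors certifies membership: it is admissible, and in row `k`
it is tight where the smaller of `u k` and `v k` is. -/
theorem mk_min_mem_tropHull (hA : A.IsSymm) {u v : Fin n → ℝ} (hu : TropTorus.mk u ∈ tropHull A)
    (hv : TropTorus.mk v ∈ tropHull A) :
    TropTorus.mk (fun k => min (u k) (v k)) ∈ tropHull A := by
  have h1 := dualPair_of_mk_mem hA hu
  have h2 := dualPair_of_mk_mem hA hv
  have hle : ∀ k i, min (u k) (v k) + max (tropDual A u i) (tropDual A v i) ≤ A k i := by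
    intro k i
    have := h1.le k i
    have := h2.le k i
    rcases max_cases (tropDual A u i) (tropDual A v i) with h | h <;>
      linarith [min_le_left (u k) (v k), min_le_right (u k) (v k)]
  refine mk_mem_tropHull_of_tight (z := fun i => max (tropDual A u i) (tropDual A v i)) hle
    fun k => ?_
  rcases le_total (u k) (v k) with h | h
  · obtain ⟨i, hi⟩ := h1.row k
    refine ⟨i, le_antisymm (hle k i) ?_⟩
    rw [min_eq_left h]
    linarith [le_max_left (tropDual A u i) (tropDual A v i)]
  · obtain ⟨i, hi⟩ := h2.row k
    refine ⟨i, le_antisymm (hle k i) ?_⟩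
    rw [min_eq_right h]
    linarith [le_max_right (tropDual A u i) (tropDual A v i)]

theorem tropHull_geodesic (hA : A.IsSymm) (p q : tropHull A) : ∃ γ : ℝ → tropHull A,
    γ 0 = p ∧ γ (dist p q) = q ∧
    ∀ s ∈ Set.Icc 0 (dist p q), ∀ t ∈ Set.Icc 0 (dist p q), dist (γ s) (γ t) = |s - t| := by
  obtain ⟨p, hp⟩ := p
  obtain ⟨q, hq⟩ := q
  obtain ⟨x, rfl⟩ := TropTorus.mk_surjective p
  obtain ⟨f, hf, rfl⟩ := exists_isAbove x hq
  -- The geodesic truncates the slack vector at height `t`; each truncation is the entrywise minimum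
  -- of `t + x` and `x + f`.
  have hmem : ∀ t : ℝ, TropTorus.mk (fun k => x k + min (f k) t) ∈ tropHull A := by
    intro t
    have := mk_min_mem_tropHull hA (u := fun k => t + x k) (v := x + f)
      (by rw [mk_add_const]; exact hp) hf.mem
    convert this using 2
    funext k
    simp only [Pi.add_apply]
    rw [min_comm, ← min_add_add_left, add_comm t]
  have hd : dist (⟨_, hp⟩ : tropHull A) ⟨_, hf.mem⟩ = ⨆ k, f k := dist_mk_add hf.slack x
  rw [hd]
  obtain ⟨m, hm⟩ := exists_eq_ciSup_of_finite (f := f)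
  obtain ⟨z, hz⟩ := hf.slack.2
  refine ⟨fun t => ⟨_, hmem t⟩, Subtype.ext ?_, Subtype.ext ?_, ?_⟩
  · simp [hf.slack.1]
  · simp only [min_eq_left (le_iSup_fin f _)]
    rfl
  · have key : ∀ s ∈ Set.Icc 0 (⨆ k, f k), ∀ t ∈ Set.Icc 0 (⨆ k, f k), s ≤ t →
        hilbertDist (fun k => x k + min (f k) t) (fun k => x k + min (f k) s) = t - s := by
      intro s hs t ht hst
      refine (hilbertDist_eq_sub (a := 0) (b := t - s) (fun k => ?_) ⟨z, ?_⟩ ⟨m, ?_⟩).trans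
        (sub_zero _)
      · rcases min_cases (f k) s with h1 | h1 <;> rcases min_cases (f k) t with h2 | h2 <;>
          constructor <;> linarith
      · rw [hz, min_eq_left hs.1, min_eq_left ht.1, sub_self]
      · rw [hm, min_eq_right hs.2, min_eq_right ht.2]
        ring
    intro s hs t ht
    show hilbertDist _ _ = _
    rcases le_total s t with h | h
    · rw [hilbertDist_comm, key s hs t ht h, abs_sub_comm, abs_of_nonneg (by linarith)]
    · rw [key t ht s hs h, abs_of_nonneg (by linarith)]

theorem HasSymTropRank.isMetricTree (hA : HasSymTropRank 2 A) : IsMetricTree (tropHull A) where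
  geodesic := tropHull_geodesic hA.1
  four_point := by
    rintro ⟨p, hp⟩ ⟨q, hq⟩ ⟨r, hr⟩ ⟨s, hs⟩
    simp only [Subtype.dist_eq]
    obtain ⟨x, y, hxy, rfl⟩ := exists_dualPair hA.1 hp
    obtain ⟨f, hf, rfl⟩ := exists_isAbove x hq
    obtain ⟨g, hg, rfl⟩ := exists_isAbove x hr
    obtain ⟨h, hh, rfl⟩ := exists_isAbove x hs
    rw [dist_mk_add hf.slack, dist_mk_add hg.slack, dist_mk_add hh.slack, hg.dist_eq hA hxy hh,
      hf.dist_eq hA hxy hh, hf.dist_eq hA hxy hg]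
    have := slackProd_ultra (f := g) (g := h) (h := f) (hh.ultraRel hA hxy hf)
    rw [slackProd_comm g f] at this
    rcases min_le_iff.1 this with e | e
    · exact le_max_of_le_right (by linarith)
    · exact le_max_of_le_left (by linarith)

omit [NeZero n] in
/-- The `i`-th column has slack vector `A_{ki} - x_k - y_i` with respect to the point of `x`. -/
theorem DualPair.isAbove_col (h : DualPair A x y) (i : Fin n) :
    IsAbove A x (fun k => A k i - x k - y i) ∧
      (colPoint A i : TropTorus n) = TropTorus.mk (x + fun k => A k i - x k - y i) := by
  have e : (colPoint A i : TropTorus n) = TropTorus.mk (x + fun k => A k i - x k - y i) :=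
    TropTorus.mk_eq_mk.2 ⟨y i, fun k => by simp only [Pi.add_apply]; ring⟩
  refine ⟨⟨⟨fun k => by linarith [h.le k i], ?_⟩, e ▸ (colPoint A i).2⟩, e⟩
  exact (h.col i).imp fun k hk => by linarith

/-- Pick a row `l` where the slack vector `g` of `v` is positive and a column `i` tight there. The
ultrametric relation at `l` then makes the supports of `g` and of column `i` disjoint, so their
Gromov product at `u` is zero. -/
theorem HasSymTropRank.exists_col_beyond (hA : HasSymTropRank 2 A) {u v : tropHull A}
    (huv : u ≠ v) : ∃ i, u ∈ treePath (colPoint A i) v := by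
  obtain ⟨u, hu⟩ := u
  obtain ⟨v, hv⟩ := v
  obtain ⟨x, y, hxy, rfl⟩ := exists_dualPair hA.1 hu
  obtain ⟨g, hg, rfl⟩ := exists_isAbove x hv
  obtain ⟨l, hl⟩ : ∃ l, 0 < g l := by
    by_contra! hcon
    apply huv
    refine Subtype.ext (congrArg TropTorus.mk (funext fun k => ?_))
    have := le_antisymm (hcon k) (hg.slack.1 k)
    simp [this]
  obtain ⟨i, hi⟩ := hxy.row l
  refine ⟨i, ?_⟩
  obtain ⟨hf, hcol⟩ := hxy.isAbove_col i
  show dist (colPoint A i : TropTorus n) _ + dist _ _ = dist (colPoint A i : TropTorus n) _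
  rw [hcol]
  show _ + dist (TropTorus.mk x) (TropTorus.mk (x + g)) = dist _ (TropTorus.mk (x + g))
  rw [dist_comm, dist_mk_add hf.slack, dist_mk_add hg.slack, hf.dist_eq hA hxy hg]
  set f : Fin n → ℝ := fun k => A k i - x k - y i with hfdef
  have hfl : f l = 0 := by simp only [hfdef]; linarith
  have : slackProd f g = 0 := by
    refine iSup_fin_eq (fun k => ?_) ⟨l, by rw [hfl, min_eq_left hl.le]⟩
    rcases (hf.ultraRel hA hxy hg) l k with h | h | h
    · rw [hfl] at h; linarith
    · exact (min_le_right _ _).trans (by rwa [hfl] at h)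
    · exact (min_le_left _ _).trans (by rwa [hfl] at h)
  rw [this]
  ring

end Hull

/-! ### The tree of a symmetric matrix of symmetric tropical rank two -/

section MatrixTree

variable {n : ℕ} [NeZero n] {A : Matrix (Fin n) (Fin n) ℝ} {x y : Fin n → ℝ}

theorem HasSymTropRank.exists_ray_beyond (hA : HasSymTropRank 2 A) {u v : tropHull A}
    (huv : u ≠ v) : ∃ i, u ∈ treePath (rayPoint hA.1 i) v := by
  set φ := hullInvolution hA.1 with hφ
  obtain ⟨i, hi⟩ := hA.exists_col_beyond (φ.injective.ne huv)
  refine ⟨i, ?_⟩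
  have hi : dist (colPoint A i) (φ u) + dist (φ u) (φ v) = dist (colPoint A i) (φ v) := hi
  show dist (φ (colPoint A i)) u + dist u v = dist (φ (colPoint A i)) v
  have hinv : ∀ w, dist (φ (colPoint A i)) w = dist (colPoint A i) (φ w) := fun w => by
    rw [← φ.dist_eq (colPoint A i), hullInvolution_involutive hA.1 w]
  rw [hinv, hinv, ← φ.dist_eq u v, hi]

theorem HasSymTropRank.isBicoloredTree (hA : HasSymTropRank 2 A) :
    IsBicoloredTree (matrixTree A (rayPoint hA.1)) where
  tree := hA.isMetricTree
  spanned p := by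
    by_cases h : p = colPoint A 0
    · refine ⟨Sum.inl 0, Sum.inl 0, ?_⟩
      rw [h]
      show dist (colPoint A 0) (colPoint A 0) + _ = _
      simp [matrixTree]
    · obtain ⟨i, hi⟩ := hA.exists_col_beyond h
      exact ⟨Sum.inl i, Sum.inl 0, hi⟩
  bicolored u v huv :=
    ⟨⟨hA.exists_col_beyond huv.1, hA.exists_ray_beyond huv.1⟩,
      hA.exists_col_beyond huv.1.symm, hA.exists_ray_beyond huv.1.symm⟩

theorem isCompact_tropHull (hA : A.IsSymm) : IsCompact (tropHull A) := by
  set F : (Fin n → ℝ) → TropTorus n := fun c => TropTorus.mk fun k => ⨅ i, (c i + A k i) with hF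
  have hle : ∀ (c c' : Fin n → ℝ) (k : Fin n),
      (⨅ i, (c i + A k i)) - (⨅ i, (c' i + A k i)) ≤ dist c c' := by
    intro c c' k
    obtain ⟨i, hi⟩ := exists_eq_ciInf_of_finite (f := fun i => c' i + A k i)
    have h1 := iInf_fin_le (fun i => c i + A k i) i
    have h2 := (le_abs_self _).trans (dist_le_pi_dist c c' i)
    linarith
  have hcont : Continuous F := by
    refine (LipschitzWith.of_dist_le_mul (K := 2) fun c c' => ?_).continuous
    refine hilbertDist_le_iff.2 fun k l => ?_
    have h1 := hle c c' k
    have h2 := hle c' c l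
    rw [dist_comm] at h2
    push_cast
    linarith
  obtain ⟨⟨k₁, i₁⟩, hM⟩ := Finite.exists_max fun r : Fin n × Fin n => |A r.1 r.2|
  have hM : ∀ k i, |A k i| ≤ |A k₁ i₁| := fun k i => hM (k, i)
  -- The coefficients can be normalized to `y 0 - y i`, a difference bounded by a difference of two
  -- entries of `A`.
  have : tropHull A = F '' Metric.closedBall 0 (2 * |A k₁ i₁|) := by
    refine Set.Subset.antisymm (fun p hp => ?_) ?_
    · obtain ⟨x, y, h, rfl⟩ := exists_dualPair hA hp
      refine ⟨fun i => y 0 - y i, ?_, TropTorus.mk_eq_mk.2 ⟨y 0, fun k => ?_⟩⟩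
      · rw [mem_closedBall_zero_iff, pi_norm_le_iff_of_nonneg (by positivity)]
        intro i
        obtain ⟨k, hk⟩ := h.col i
        obtain ⟨l, hl⟩ := h.col 0
        have h1 := h.le k 0
        have h2 := h.le l i
        have b1 := abs_le.1 (hM k i)
        have b2 := abs_le.1 (hM k 0)
        have b3 := abs_le.1 (hM l 0)
        have b4 := abs_le.1 (hM l i)
        rw [Real.norm_eq_abs, abs_le]
        constructor <;> linarith
      · refine iInf_fin_eq (fun i => ?_) ?_
        · linarith [h.le k i]
        · exact (h.row k).imp fun i hi => by linarith
    · rintro _ ⟨c, -, rfl⟩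
      exact ⟨c, rfl⟩
  rw [this]
  exact (isCompact_closedBall _ _).image hcont

theorem exists_dualPair_self (hA : A.IsSymm) {p : tropHull A} (hp : hullInvolution hA p = p) :
    ∃ x, DualPair A x x ∧ (p : TropTorus n) = TropTorus.mk x := by
  obtain ⟨x, y, h, hx⟩ := exists_dualPair hA p.2
  have h1 : hullDual A p = p := congrArg Subtype.val hp
  rw [hx, h.hullDual_eq hA] at h1
  obtain ⟨a, ha⟩ := TropTorus.mk_eq_mk.1 h1
  -- Being fixed only means `y = a + x`; shifting by `a / 2` makes the two vectors equal.
  refine ⟨fun k => a / 2 + x k, ?_, by rw [mk_add_const, hx]⟩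
  have h2 := h.add_const (a / 2)
  have : (fun i => y i - a / 2) = fun k => a / 2 + x k := by
    funext i
    rw [ha]; ring
  rwa [this] at h2

/-- In the direction of a fixed point some diagonal entry has positive slack. -/
theorem exists_diag_slack_pos (hA : A.IsSymm) (h : DualPair A x x) {p : tropHull A}
    (hp : hullInvolution hA p = p) {f : Fin n → ℝ} (hf : IsAbove A x f)
    (hpf : (p : TropTorus n) = TropTorus.mk (x + f)) (hne : (p : TropTorus n) ≠ TropTorus.mk x) :
    ∃ k, 0 < f k ∧ 0 < A k k - x k - x k := by
  obtain ⟨k, hk⟩ := exists_eq_ciSup_of_finite (f := f)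
  have hpos : 0 < f k := by
    by_contra! hcon
    refine hne (hpf.trans (congrArg TropTorus.mk (funext fun l => ?_)))
    have := le_antisymm ((le_iSup_fin f l).trans (hk ▸ hcon)) (hf.slack.1 l)
    simp [this]
  obtain ⟨z, hz, hpz⟩ := exists_dualPair_self hA hp
  obtain ⟨b, hb⟩ := TropTorus.mk_eq_mk.1 (hpz.symm.trans hpf)
  simp only [Pi.add_apply] at hb
  obtain ⟨m, hm⟩ := hf.slack.2
  -- With `z = b + x + f` and `f m = 0`, tightness at `(m, l)` gives `2b ≥ -f l ≥ -f k`. So the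
  -- diagonal slack at `k` is at least `2b + 2 f k ≥ f k > 0`.
  obtain ⟨l, hl⟩ := hz.row m
  have h1 := h.le m l
  have h2 := hz.le k k
  have h3 := le_iSup_fin f l
  exact ⟨k, hpos, by linarith [hb k, hb l, hb m]⟩

/-- Three fixed directions at `m` would supply indices `i, j, k` with positive diagonal slack, one
in each branch. Slacks between different branches vanish, so in the principal minor of `i, j, k` the
`3`-cycle monomial would be the unique minimum. -/
theorem HasSymTropRank.no_tripod (hA : HasSymTropRank 2 A) (m u v w : tropHull A)
    (hm : hullInvolution hA.1 m = m) (hu : hullInvolution hA.1 u = u)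
    (hv : hullInvolution hA.1 v = v) (hw : hullInvolution hA.1 w = w) (huv : m ∈ treePath u v)
    (hvw : m ∈ treePath v w) (huw : m ∈ treePath u w) : m = u ∨ m = v ∨ m = w := by
  by_contra! hcon
  obtain ⟨n1, n2, n3⟩ := hcon
  obtain ⟨x, hx, hmx⟩ := exists_dualPair_self hA.1 hm
  obtain ⟨f, hf, huf⟩ := exists_isAbove x u.2
  obtain ⟨g, hg, hvg⟩ := exists_isAbove x v.2
  obtain ⟨h, hh, hwh⟩ := exists_isAbove x w.2
  have key : ∀ {u v : tropHull A} {f g : Fin n → ℝ}, IsAbove A x f → IsAbove A x g →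
      (u : TropTorus n) = TropTorus.mk (x + f) → (v : TropTorus n) = TropTorus.mk (x + g) →
      m ∈ treePath u v → slackProd f g = 0 := by
    intro u v f g hf hg huf hvg huv
    have huv : dist (u : TropTorus n) m + dist (m : TropTorus n) v = dist (u : TropTorus n) v := huv
    rw [huf, hvg, hmx, hf.dist_eq hA hx hg, dist_mk_add hg.slack, dist_comm,
      dist_mk_add hf.slack] at huv
    linarith
  have p1 := key hf hg huf hvg huv
  have p2 := key hg hh hvg hwh hvw
  have p3 := key hf hh huf hwh huw
  obtain ⟨i, hfi, hi⟩ := exists_diag_slack_pos hA.1 hx hu hf huf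
    fun e => n1 (Subtype.ext (hmx.trans e.symm))
  obtain ⟨j, hgj, hj⟩ := exists_diag_slack_pos hA.1 hx hv hg hvg
    fun e => n2 (Subtype.ext (hmx.trans e.symm))
  obtain ⟨k, hhk, hk⟩ := exists_diag_slack_pos hA.1 hx hw hh hwh
    fun e => n3 (Subtype.ext (hmx.trans e.symm))
  -- Since `g` vanishes at `i`, the relation between `g` and column `j` at `i, j` leaves only the
  -- option that the slack at `(i, j)` is zero.
  have zero : ∀ {f g : Fin n → ℝ} {i j : Fin n}, IsAbove A x f → IsAbove A x g →
      slackProd f g = 0 → 0 < f i → 0 < g j → 0 < A j j - x j - x j →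
      i ≠ j ∧ A i j = x i + x j := by
    intro f g i j hf hg hfg hi hj hjj
    have hgi : g i ≤ 0 := by
      have := le_slackProd f g i
      rw [hfg] at this
      exact (min_le_iff.1 this).resolve_left (by linarith)
    refine ⟨by rintro rfl; linarith, le_antisymm ?_ (hx.le i j)⟩
    rcases hg.ultraRel hA hx (hx.isAbove_col j).1 i j with e | e | e <;> linarith
  obtain ⟨hij, e1⟩ := zero hf hg p1 hfi hgj hj
  obtain ⟨hjk, e2⟩ := zero hg hh p2 hgj hhk hk
  obtain ⟨hik, e3⟩ := zero hf hh p3 hfi hhk hk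
  rcases hA.principal_minor hij hik hjk with e | e | e | e <;> linarith

theorem hullInvolution_leaf (hA : A.IsSymm) (s : Fin n ⊕ Fin n) :
    hullInvolution hA (matrixTree A (rayPoint hA) s) = matrixTree A (rayPoint hA) s.swap := by
  rcases s with i | i
  · rfl
  · exact hullInvolution_involutive hA _

theorem HasSymTropRank.isSymbicTree (hA : HasSymTropRank 2 A) :
    IsSymbicTree (matrixTree A (rayPoint hA.1)) where
  toIsBicoloredTree := hA.isBicoloredTree
  symmetric := by
    have : CompactSpace (tropHull A) := isCompact_iff_compactSpace.1 (isCompact_tropHull hA.1)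
    have : Nonempty (tropHull A) := ⟨colPoint A 0⟩
    exact ⟨hullInvolution hA.1, hullInvolution_involutive hA.1, hullInvolution_leaf hA.1,
      hA.isMetricTree.fixedPoints_eq_treePath (hullInvolution_involutive hA.1) hA.no_tripod⟩

/-! ### Balancing -/

omit [NeZero n] in
theorem mk_add_smul_latticeDir (x : Fin n → ℝ) (t : ℝ) (S : Finset (Fin n)) :
    TropTorus.mk x + t • latticeDir S = TropTorus.mk fun k => x k + if k ∈ S then t else 0 := by
  unfold latticeDir
  rw [← map_smul, ← map_add]
  refine congrArg _ (funext fun k => ?_)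
  simp

theorem exists_slack_gap (A : Matrix (Fin n) (Fin n) ℝ) (x y : Fin n → ℝ) :
    ∃ ε : ℝ, 0 < ε ∧ ∀ k i, 0 < A k i - x k - y i → ε ≤ A k i - x k - y i := by
  set s : Fin n × Fin n → ℝ := fun r => A r.1 r.2 - x r.1 - y r.2 with hs
  obtain ⟨r, hr⟩ := Finite.exists_min fun r => if 0 < s r then s r else 1
  refine ⟨if 0 < s r then s r else 1, ?_, fun k i h => ?_⟩
  · split_ifs with h
    · exact h
    · exact one_pos
  have := hr (k, i)
  rwa [if_pos (show 0 < s (k, i) from h)] at this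

/-- The edge directions are the nonempty supports of the columns of the slack matrix. -/
theorem HasSymTropRank.isEdgeDirection_iff (hA : HasSymTropRank 2 A) (h : DualPair A x y)
    (S : Finset (Fin n)) : IsEdgeDirection A (TropTorus.mk x) S ↔
      S.Nonempty ∧ ∃ i, ∀ k, k ∈ S ↔ 0 < A k i - x k - y i := by
  constructor
  · rintro ⟨⟨l, hl⟩, hS, ε, hε, hmem⟩
    have hmem := hmem ε hε.le le_rfl
    rw [mk_add_smul_latticeDir] at hmem
    have hu := dualPair_of_mk_mem hA.1 hmem
    set w := tropDual A fun k => x k + if k ∈ S then ε else 0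
    -- A column that is tight in row `k` after the move was already tight there before it, and had
    -- positive slack on all of `S`.
    have key : ∀ k ∉ S, ∃ i, A k i - x k - y i = 0 ∧ ∀ l ∈ S, 0 < A l i - x l - y i := by
      intro k hk
      obtain ⟨i, hi⟩ := hu.row k
      obtain ⟨q, hq⟩ := h.col i
      have e1 := hu.le q i
      have e2 := h.le k i
      have e3 : (0 : ℝ) ≤ if q ∈ S then ε else 0 := by split_ifs <;> linarith
      simp only [hk, if_false] at hi
      refine ⟨i, by linarith, fun l hl => ?_⟩
      have e4 := hu.le l i
      simp only [hl, if_true] at e4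
      linarith
    obtain ⟨k, hk⟩ : ∃ k, k ∉ S := by
      by_contra! hcon
      exact hS (Finset.eq_univ_iff_forall.2 hcon)
    obtain ⟨i, -, hi⟩ := key k hk
    refine ⟨⟨l, hl⟩, i, fun k' => ⟨hi k', fun hk' => ?_⟩⟩
    by_contra hcon
    obtain ⟨j, hj0, hj⟩ := key k' hcon
    have e1 := hi l hl
    have e2 := hj l hl
    -- Columns `i` and `j` are both positive at `l`, so positivity of column `i` at `k'` would
    -- propagate to column `j`, which vanishes there.
    rcases hA.slack_ultra h k' l j i with e | e | e <;> linarith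
  · rintro ⟨⟨l, hl⟩, i, hi⟩
    obtain ⟨ε, hε, hgap⟩ := exists_slack_gap A x y
    refine ⟨⟨l, hl⟩, ?_, ε, hε, fun t ht htε => ?_⟩
    · rintro rfl
      obtain ⟨q, hq⟩ := h.col i
      have := (hi q).1 (Finset.mem_univ q)
      linarith
    · classical
      rw [mk_add_smul_latticeDir]
      -- The dual vector drops by `t` at the columns tight in some row of `S`. Column `i` is not one
      -- of these and stays tight in every row outside `S`; the gap `ε` protects the pairs that were
      -- not tight.
      refine mk_mem_tropHull_of_tight
        (z := fun j => y j - if ∃ l ∈ S, x l + y j = A l j then t else 0) (fun k j => ?_)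
        fun k => ?_
      · have e1 := h.le k j
        split_ifs with hk hj hj
        · linarith
        · have : 0 < A k j - x k - y j := by
            rcases e1.lt_or_eq with e | e
            · linarith
            · exact absurd ⟨k, hk, e⟩ hj
          have := hgap k j this
          linarith
        · linarith
        · linarith
      · by_cases hk : k ∈ S
        · obtain ⟨j, hj⟩ := h.row k
          refine ⟨j, ?_⟩
          rw [if_pos hk, if_pos ⟨k, hk, hj⟩]
          linarith
        · refine ⟨i, ?_⟩
          rw [if_neg hk, if_neg]
          · have e1 := h.le k i
            have e2 := mt (hi k).2 hk
            linarith
          · rintro ⟨q, hq, hq'⟩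
            have := (hi q).1 hq
            linarith

/-- By duality, the ray `k` is attached at the point of `x` iff the `k`-th column represents `y`. -/
theorem rayPoint_eq_iff (hA : A.IsSymm) (h : DualPair A x y) (k : Fin n) {p : tropHull A}
    (hp : (p : TropTorus n) = TropTorus.mk x) :
    rayPoint hA k = p ↔ ∀ i, A k i - x k - y i = 0 := by
  have h1 : rayPoint hA k = p ↔ TropTorus.mk (fun i => A i k) = TropTorus.mk y := by
    rw [← h.hullDual_eq hA, ← hp]
    constructor
    · intro e
      rw [← e]
      exact (congrArg Subtype.val (hullInvolution_involutive hA (colPoint A k))).symm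
    · intro e
      have : colPoint A k = hullInvolution hA p := Subtype.ext e
      rw [rayPoint, this, hullInvolution_involutive hA p]
  rw [h1, TropTorus.mk_eq_mk]
  constructor
  · rintro ⟨c, hc⟩ i
    obtain ⟨j, hj⟩ := h.row k
    have e1 := hc j
    have e2 := hc i
    rw [hA.apply k j] at e1
    rw [hA.apply k i] at e2
    linarith
  · intro e
    refine ⟨x k, fun i => ?_⟩
    rw [hA.apply k i]
    linarith [e i]

omit [NeZero n] in
open Classical in
theorem sum_latticeDir_add (E : Finset (Finset (Fin n))) (R : Finset (Fin n)) :
    (∑ S ∈ E, latticeDir S) + ∑ j ∈ R, latticeDir {j} = TropTorus.mk fun k : Fin n =>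
      (∑ S ∈ E, if k ∈ S then (1 : ℝ) else 0) + if k ∈ R then 1 else 0 := by
  unfold latticeDir
  rw [← map_sum, ← map_sum, ← map_add]
  refine congrArg _ (funext fun k => ?_)
  simp

/-- Each `k` is counted exactly once: if row `k` of the slack matrix is zero, by the ray `k`;
otherwise by the single column support containing `k`. The sum is therefore `(1, …, 1)`. -/
theorem HasSymTropRank.isBalancing (hA : HasSymTropRank 2 A) :
    IsBalancing A (rayPoint hA.1) := by
  classical
  intro p
  obtain ⟨x, y, h, hp⟩ := exists_dualPair hA.1 p.2
  rw [sum_latticeDir_add, ← map_zero TropTorus.mk, TropTorus.mk_eq_mk]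
  refine ⟨1, fun k => ?_⟩
  simp only [Finset.mem_filter, Finset.mem_univ, true_and, Pi.zero_apply, add_zero]
  have hray := rayPoint_eq_iff hA.1 h k hp
  rw [hp]
  by_cases hk : rayPoint hA.1 k = p
  · rw [if_pos hk, Finset.sum_eq_zero, zero_add]
    rw [hray] at hk
    intro S hS
    obtain ⟨-, i, hi⟩ := (hA.isEdgeDirection_iff h S).1 (Finset.mem_filter.1 hS).2
    rw [if_neg]
    rw [hi, hk i]
    exact lt_irrefl 0
  · rw [if_neg hk, add_zero]
    rw [hray] at hk
    push Not at hk
    obtain ⟨i, hi⟩ := hk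
    have hi : 0 < A k i - x k - y i := lt_of_le_of_ne (by linarith [h.le k i]) hi.symm
    rw [Finset.sum_eq_single (Finset.univ.filter fun l => 0 < A l i - x l - y i)]
    · refine if_pos (Finset.mem_filter.2 ⟨Finset.mem_univ k, ?_⟩)
      exact hi
    · intro S hS hne
      obtain ⟨-, j, hj⟩ := (hA.isEdgeDirection_iff h S).1 (Finset.mem_filter.1 hS).2
      rw [if_neg]
      intro hkS
      rw [hj] at hkS
      refine hne (Finset.ext fun l => ?_)
      rw [hj, Finset.mem_filter]
      simp only [Finset.mem_univ, true_and]
      constructor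
      · intro hl
        rcases hA.slack_ultra h l k i j with e | e | e <;> linarith
      · intro hl
        rcases hA.slack_ultra h l k j i with e | e | e <;> linarith
    · intro hS
      refine absurd (Finset.mem_filter.2 ⟨Finset.mem_univ _, ?_⟩) hS
      exact (hA.isEdgeDirection_iff h _).2 ⟨⟨k, by simpa using hi⟩, i, fun l => by simp⟩

/-- The edge contributions cancel when two balancings are compared at a point, so the sets of
attached rays differ by a constant vector. If ray `k` is missing at `rayPoint k`, that constant is
`1`; then all dual points coincide, hence all columns do, and the hull is a single point. -/
theorem HasSymTropRank.eq_rayPoint (hA : HasSymTropRank 2 A) {ray : Fin n → tropHull A}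
    (hray : IsBalancing A ray) : ray = rayPoint hA.1 := by
  classical
  funext k
  by_contra hne
  have h1 := hray (rayPoint hA.1 k)
  have h2 := hA.isBalancing (rayPoint hA.1 k)
  rw [sum_latticeDir_add] at h1 h2
  obtain ⟨c, hc⟩ := TropTorus.mk_eq_mk.1 (h2.trans h1.symm)
  have hall : ∀ j, rayPoint hA.1 j = rayPoint hA.1 k := by
    intro j
    have e1 := hc k
    have e2 := hc j
    by_contra hj
    simp only [Finset.mem_filter, Finset.mem_univ, true_and, if_true, hne, if_false, hj] at e1 e2
    split_ifs at e2 <;> linarith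
  have hcol : ∀ j, colPoint A j = colPoint A k := fun j =>
    (hullInvolution hA.1).injective (hall j)
  have hpt : ∀ q, q = colPoint A k := by
    intro q
    by_contra hq
    obtain ⟨i, hi⟩ := hA.exists_col_beyond hq
    have hi : dist (colPoint A i) q + dist q (colPoint A k) = dist (colPoint A i) (colPoint A k) := hi
    rw [hcol i, dist_self, dist_comm] at hi
    exact hq (dist_eq_zero.1 (by linarith [dist_nonneg (x := q) (y := colPoint A k)]))
  exact hne ((hpt _).trans (hpt _).symm)

/-- The entries of the matrix are recovered, up to scaling, from the distances in its tree. -/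
theorem HasSymTropRank.exists_eq_dist (hA : HasSymTropRank 2 A) :
    ∃ c : Fin n → ℝ, ∀ i k, A i k = c i + c k - dist (colPoint A i) (rayPoint hA.1 k) / 2 := by
  -- Basing at a fixed point makes the slack matrix symmetric, so `S i` is the distance from the
  -- base both to column `i` and to ray `i`.
  obtain ⟨m, hm1, hm2⟩ := hA.isMetricTree.exists_midpoint (colPoint A 0)
    (hullInvolution hA.1 (colPoint A 0))
  obtain ⟨x, h, -⟩ := exists_dualPair_self hA.1
    (hA.isMetricTree.midpoint_fixed (hullInvolution_involutive hA.1) hm1 hm2)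
  have hs := fun k i => hA.1.apply k i
  set S : Fin n → ℝ := fun i => ⨆ l, (A l i - x l - x i) with hS
  have hle : ∀ l i, A l i - x l - x i ≤ S i := fun l i =>
    le_iSup_fin (fun l => A l i - x l - x i) l
  have hex : ∀ i, ∃ l, A l i - x l - x i = S i := fun i => exists_eq_ciSup_of_finite
  refine ⟨fun i => x i + S i / 2, fun i k => ?_⟩
  -- In terms of slacks this reads `S i + S k - 2 s_{ik}`: the slack `s_{ik}` is the Gromov product
  -- of column `i` and ray `k`.
  have hd : dist (colPoint A i) (rayPoint hA.1 k) = (S i + S k + x i + x k - (A i k - x i - x k)) -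
      A i k := by
    have : dist (colPoint A i) (rayPoint hA.1 k) =
        hilbertDist (fun l => A l i) (tropDual A fun l => A l k) := by
      show dist (TropTorus.mk fun l => A l i) (hullDual A (TropTorus.mk fun l => A l k)) = _
      rw [hullDual_mk, TropTorus.dist_mk]
    rw [this]
    have upper : ∀ l, A l i - tropDual A (fun l => A l k) l ≤
        S i + S k + x i + x k - (A i k - x i - x k) := by
      intro l
      obtain ⟨j, hj⟩ := exists_eq_tropDual A (fun l => A l k) l
      rw [← hj]
      have e1 := hle l i
      have e2 := hle j k
      have e3 := hle i k
      have e4 := hle k i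
      have e5 := hs j k
      rcases hA.slack_ultra h l k j i with e | e | e <;> linarith [hs i k]
    refine hilbertDist_eq_sub (fun l => ⟨?_, upper l⟩) ⟨k, ?_⟩ ?_
    · have := tropDual_le A (fun l => A l k) l i
      linarith
    · have : tropDual A (fun l => A l k) k = 0 := by
        refine iInf_fin_eq (fun j => ?_) ⟨k, sub_self _⟩
        rw [hs j k]; simp
      rw [this, sub_zero, hs i k]
    -- Try `l` and `j` maximizing the slacks of columns `i` and `k`. If `s_{lj}` is too large, the
    -- ultrametric relation gives `S k ≤ s_{ik}` or `S i ≤ s_{ik}`, and one of the two indices is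
    -- replaced by one tight with the other.
    · suffices ∃ l j, S i + S k - (A i k - x i - x k) ≤
          (A l i - x l - x i) - (A l j - x l - x j) + (A j k - x j - x k) by
        obtain ⟨l, j, hlj⟩ := this
        refine ⟨l, le_antisymm (upper l) ?_⟩
        have := tropDual_le A (fun l => A l k) l j
        linarith
      obtain ⟨l, hl⟩ := hex i
      obtain ⟨j, hj⟩ := hex k
      rcases le_or_gt (A l j - x l - x j) (A i k - x i - x k) with e | e
      · exact ⟨l, j, by linarith⟩
      · rcases hA.slack_ultra h k l i j with e' | e' | e'
        · obtain ⟨q, hq⟩ := h.row l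
          have := h.le q k
          refine ⟨l, q, ?_⟩
          rw [hs j k, hs i k] at e'
          linarith
        · rw [hs i k] at e'
          linarith
        · obtain ⟨q, hq⟩ := h.col j
          have := h.le q i
          refine ⟨q, j, ?_⟩
          rw [hs i k] at e'
          linarith
  rw [hd]
  ring

end MatrixTree

/-! ### The matrix of a symbic tree -/

section TreeMatrix

variable {X : Type*} [MetricSpace X]

/-- Gromov products in a metric tree satisfy a bipartite ultrametric inequality. -/
theorem IsMetricTree.four_point_ultra (h : IsMetricTree X) (o k l i j : X) :
    dist k i - dist k o - dist i o ≤ dist k j - dist k o - dist j o ∨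
    dist k i - dist k o - dist i o ≤ dist l j - dist l o - dist j o ∨
    dist k i - dist k o - dist i o ≤ dist l i - dist l o - dist i o := by
  have h1 := h.four_point k i j o
  have h2 := h.four_point i j l o
  rw [dist_comm i l, dist_comm j l] at h2
  rw [le_max_iff] at h1 h2
  rcases h1 with h1 | h1
  · left; linarith
  · rcases h2 with h2 | h2
    · right; right; linarith
    · right; left; linarith

/-- With Gromov products based at `b₃` the third column contributes zero, so only the entries of the
first two columns matter. Two applications of the ultrametric inequality contradict strict
maximality of the diagonal term. -/
theorem IsMetricTree.max_minor (h : IsMetricTree X) (a₁ a₂ a₃ b₁ b₂ b₃ : X) :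
    dist a₁ b₁ + dist a₂ b₂ + dist a₃ b₃ ≤ dist a₁ b₁ + dist a₃ b₂ + dist a₂ b₃ ∨
    dist a₁ b₁ + dist a₂ b₂ + dist a₃ b₃ ≤ dist a₂ b₁ + dist a₁ b₂ + dist a₃ b₃ ∨
    dist a₁ b₁ + dist a₂ b₂ + dist a₃ b₃ ≤ dist a₂ b₁ + dist a₃ b₂ + dist a₁ b₃ ∨
    dist a₁ b₁ + dist a₂ b₂ + dist a₃ b₃ ≤ dist a₃ b₁ + dist a₁ b₂ + dist a₂ b₃ ∨
    dist a₁ b₁ + dist a₂ b₂ + dist a₃ b₃ ≤ dist a₃ b₁ + dist a₂ b₂ + dist a₁ b₃ := by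
  by_contra! hcon
  obtain ⟨c1, c2, c3, c4, c5⟩ := hcon
  rcases h.four_point_ultra b₃ a₁ a₃ b₁ b₂ with e | e | e <;>
    rcases h.four_point_ultra b₃ a₂ a₃ b₂ b₁ with e' | e' | e' <;> linarith

variable {n : ℕ} {leaf : Fin n ⊕ Fin n → X}

theorem IsSymbicTree.dist_comm_leaf (h : IsSymbicTree leaf) (i j : Fin n) :
    dist (leaf (Sum.inl i)) (leaf (Sum.inr j)) = dist (leaf (Sum.inl j)) (leaf (Sum.inr i)) := by
  obtain ⟨φ, -, hleaf, -⟩ := h.symmetric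
  rw [← φ.dist_eq, hleaf, hleaf, dist_comm]
  rfl

/-- The midpoint of `i` and `i'` is fixed, hence lies on the path of fixed points. The middle one of
three such midpoints determines which transposition term is compared with the `3`-cycle term. -/
theorem IsSymbicTree.principal_minor (h : IsSymbicTree leaf) {D : Fin n → Fin n → ℝ}
    (hD : ∀ i j, D i j = dist (leaf (Sum.inl i)) (leaf (Sum.inr j))) (a b c : Fin n) :
    D a b + D a c ≤ D a a + D b c ∨ D a b + D b c ≤ D b b + D a c ∨
      D a c + D b c ≤ D c c + D a b := by
  have ht := h.tree
  have hsymm : ∀ i j, D i j = D j i := fun i j => by rw [hD, hD, h.dist_comm_leaf]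
  obtain ⟨φ, hφ, hleaf, p, q, hpq⟩ := h.symmetric
  have hswap : ∀ i, φ (leaf (Sum.inl i)) = leaf (Sum.inr i) := fun i => hleaf _
  choose m hm hm' using fun i => ht.exists_midpoint (leaf (Sum.inl i)) (leaf (Sum.inr i))
  have hfix : ∀ i, φ (m i) = m i := fun i => by
    refine ht.midpoint_fixed hφ (x := leaf (Sum.inl i)) ?_ ?_
    · rw [hswap, hm]
    · rw [hswap, hm']
  have hpath : ∀ i, m i ∈ treePath p q := fun i => by
    rw [← hpq]
    exact hfix i
  have hmid : ∀ i, m i ∈ treePath (leaf (Sum.inl i)) (leaf (Sum.inr i)) := fun i => by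
    show _ + _ = _
    rw [hm, hm']
    ring
  have hmm : ∀ i j, dist (m i) (m j) = |dist p (m i) - dist p (m j)| := by
    intro i j
    have h1 : dist p (m i) + dist (m i) q = dist p q := hpath i
    have h2 : dist p (m j) + dist (m j) q = dist p q := hpath j
    rw [ht.dist_of_mem_treePath (hpath i), dist_comm q, abs_sub_comm, abs_eq_max_neg]
    congr 1
    linarith
  have hupper : ∀ i j, D i j ≤ D i i / 2 + D j j / 2 + |dist p (m i) - dist p (m j)| := by
    intro i j
    have h1 := dist_triangle (leaf (Sum.inl i)) (m i) (leaf (Sum.inr j))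
    have h2 := dist_triangle (m i) (m j) (leaf (Sum.inr j))
    rw [hm] at h1
    rw [hm', hmm] at h2
    rw [hD, hD, hD]
    linarith
  -- The distance formula shows that the larger of `d(i, j)` and `d(i, j')` equals the right-hand
  -- side. As this exceeds `(D i i + D j j)/2`, the four-point condition prevents `d(i, j)` from
  -- being strictly larger than `d(i, j')`.
  have heq : ∀ i j, dist p (m i) ≠ dist p (m j) →
      D i j = D i i / 2 + D j j / 2 + |dist p (m i) - dist p (m j)| := by
    intro i j hne
    have hpos : 0 < |dist p (m i) - dist p (m j)| := abs_pos.2 (sub_ne_zero.2 hne)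
    refine le_antisymm (hupper i j) ?_
    have e1 : dist (leaf (Sum.inr i)) (m j) = dist (leaf (Sum.inl i)) (m j) := by
      rw [← hswap, ← hfix j, φ.dist_eq, hfix]
    have e2 := ht.dist_of_mem_treePath (hmid i) (m j)
    rw [e1, hmm, hm, hm', max_self] at e2
    have e3 := ht.dist_of_mem_treePath (hmid j) (leaf (Sum.inl i))
    have e4 := h.dist_comm_leaf i j
    rw [hm, hm', dist_comm (m j), dist_comm (leaf (Sum.inr j)),
      dist_comm (leaf (Sum.inl j))] at e3
    have e5 := ht.four_point (leaf (Sum.inl i)) (leaf (Sum.inl j)) (leaf (Sum.inr i))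
      (leaf (Sum.inr j))
    have e6 : dist (leaf (Sum.inr i)) (leaf (Sum.inr j)) =
        dist (leaf (Sum.inl i)) (leaf (Sum.inl j)) := by
      rw [← hswap, ← hswap, φ.dist_eq]
    rw [e6, le_max_iff] at e5
    simp only [hD] at *
    rcases max_cases (dist (leaf (Sum.inl i)) (leaf (Sum.inl j)) -
        dist (leaf (Sum.inl j)) (leaf (Sum.inr j)) / 2)
      (dist (leaf (Sum.inl i)) (leaf (Sum.inr j)) -
        dist (leaf (Sum.inl j)) (leaf (Sum.inr j)) / 2) with h1 | h1 <;>
      rcases e5 with e5 | e5 <;> linarith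
  have hord : ∀ a b c, dist p (m a) ≤ dist p (m b) → dist p (m b) ≤ dist p (m c) →
      D a b + D b c ≤ D b b + D a c ∨ D a b + D a c ≤ D a a + D b c := by
    intro a b c hab hbc
    have u1 := hupper a b
    have u2 := hupper b c
    rw [abs_of_nonpos (by linarith)] at u1 u2
    -- If all three midpoints coincide, failure of both alternatives would add up to a contradiction
    -- with the upper bound for `D a b`.
    by_cases hac : dist p (m a) = dist p (m c)
    · by_contra! hcon
      have : dist p (m a) = dist p (m b) := by linarith
      linarith
    · have u3 := heq a c hac
      rw [abs_of_nonpos (by linarith)] at u3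
      left; linarith
  have s1 := hsymm a b
  have s2 := hsymm a c
  have s3 := hsymm b c
  rcases le_total (dist p (m a)) (dist p (m b)) with h1 | h1 <;>
    rcases le_total (dist p (m b)) (dist p (m c)) with h2 | h2
  · rcases hord a b c h1 h2 with e | e
    · right; left; linarith
    · left; linarith
  · rcases le_total (dist p (m a)) (dist p (m c)) with h3 | h3
    · rcases hord a c b h3 h2 with e | e
      · right; right; linarith
      · left; linarith
    · rcases hord c a b h3 h1 with e | e
      · left; linarith
      · right; right; linarith
  · rcases le_total (dist p (m a)) (dist p (m c)) with h3 | h3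
    · rcases hord b a c h1 h3 with e | e
      · left; linarith
      · right; left; linarith
    · rcases hord b c a h2 h3 with e | e
      · right; right; linarith
      · right; left; linarith
  · rcases hord c b a h2 h1 with e | e
    · right; left; linarith
    · right; right; linarith

/-- If two terms of a symmetric `3 × 3` minor agree, the minor is principal and the terms are the
ones of the two `3`-cycles. -/
theorem exists_cycle_of_permExponent_eq {r c : Fin 3 → Fin n} (hr : Function.Injective r)
    (hc : Function.Injective c) {σ τ : Equiv.Perm (Fin 3)}
    (h : permExponent r c σ = permExponent r c τ) (hne : σ ≠ τ) :
    ∃ i j k : Fin 3, i ≠ j ∧ i ≠ k ∧ j ≠ k ∧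
      r (σ i) = c j ∧ r (σ j) = c k ∧ r (σ k) = c i := by
  have hfp := (forall_ne_of_permExponent_eq hr hc h hne).1
  have key : ∀ a, ∃ b, a ≠ b ∧ r (σ a) = c b := by
    intro a
    obtain ⟨b, ⟨e1, e2⟩ | ⟨e1, e2⟩⟩ := exists_term_of_permExponent_eq h a
    · rw [hc e2] at e1
      exact absurd (hr e1) (hfp b)
    · refine ⟨b, ?_, e1⟩
      rintro rfl
      exact hfp a (hr (e1.trans e2))
  obtain ⟨b, hb, hb'⟩ := key 0
  obtain ⟨d, hd, hd'⟩ := key b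
  -- If `0` and `b` were exchanged, the third index would have no possible partner.
  have hd0 : d ≠ 0 := by
    rintro rfl
    obtain ⟨e, he⟩ := (by decide : ∀ b : Fin 3, ∃ e, e ≠ 0 ∧ e ≠ b) b
    obtain ⟨f, hf, hf'⟩ := key e
    have hf0 : f ≠ 0 := by
      rintro rfl
      exact he.2 (σ.injective (hr (hf'.trans hd'.symm)))
    have hfb : f ≠ b := by
      rintro rfl
      exact he.1 (σ.injective (hr (hf'.trans hb'.symm)))
    omega
  obtain ⟨f, hf, hf'⟩ := key d
  have hfb : f ≠ b := by
    rintro rfl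
    exact hd0 (σ.injective (hr (hf'.trans hb'.symm)))
  have hf0 : f = 0 := by omega
  rw [hf0] at hf'
  exact ⟨0, b, d, hb, hd0.symm, hd, hb', hd', hf'⟩

theorem IsSymbicTree.hasSymTropRank (h : IsSymbicTree leaf) :
    HasSymTropRank 2 (Matrix.of fun i j : Fin n =>
      -dist (leaf (Sum.inl i)) (leaf (Sum.inr j)) / 2) := by
  set D : Fin n → Fin n → ℝ := fun i j => dist (leaf (Sum.inl i)) (leaf (Sum.inr j)) with hD
  have hDs : ∀ i j, D i j = D j i := h.dist_comm_leaf
  have hsymm : (Matrix.of fun i j : Fin n => -D i j / 2).IsSymm :=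
    Matrix.IsSymm.ext fun i j => by simp only [Matrix.of_apply, hDs i j]
  refine ⟨hsymm, fun I J => (minAttainedTwice_iff hsymm I J).2 fun σ => ?_⟩
  have hval : ∀ τ, permValue (Matrix.of fun i j : Fin n => -D i j / 2) I J τ =
      -(D (I (τ 0)) (J 0) + D (I (τ 1)) (J 1) + D (I (τ 2)) (J 2)) / 2 := fun τ => by
    simp only [permValue, Fin.sum_univ_three, Matrix.of_apply]
    ring
  by_contra! hcon
  -- Either `σ` alone produces its monomial, and every other permutation competes with it, or `σ` is
  -- a `3`-cycle of a principal minor, and only the transposition terms are needed.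
  by_cases hone : ∀ τ, permExponent I J τ = permExponent I J σ → τ = σ
  · have hlt : ∀ ρ : Equiv.Perm (Fin 3), ρ ≠ 1 →
        permValue (Matrix.of fun i j : Fin n => -D i j / 2) I J σ <
        permValue (Matrix.of fun i j : Fin n => -D i j / 2) I J (σ * ρ) := fun ρ hρ =>
      hcon _ fun e => hρ (by simpa using hone _ e)
    have hmax := h.tree.max_minor (leaf (Sum.inl (I (σ 0)))) (leaf (Sum.inl (I (σ 1))))
      (leaf (Sum.inl (I (σ 2)))) (leaf (Sum.inr (J 0))) (leaf (Sum.inr (J 1)))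
      (leaf (Sum.inr (J 2)))
    have key : ∀ ρ : Equiv.Perm (Fin 3), ρ ≠ 1 →
        D (I (σ (ρ 0))) (J 0) + D (I (σ (ρ 1))) (J 1) + D (I (σ (ρ 2))) (J 2) <
        D (I (σ 0)) (J 0) + D (I (σ 1)) (J 1) + D (I (σ 2)) (J 2) := fun ρ hρ => by
      have := hlt ρ hρ
      rw [hval, hval] at this
      simp only [Equiv.Perm.mul_apply] at this
      linarith
    have k1 := key (Equiv.swap 1 2) (by decide)
    have k2 := key (Equiv.swap 0 1) (by decide)
    have k3 := key (finRotate 3) (by decide)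
    have k4 := key (finRotate 3)⁻¹ (by decide)
    have k5 := key (Equiv.swap 0 2) (by decide)
    rw [show Equiv.swap (1 : Fin 3) 2 0 = 0 by decide, show Equiv.swap (1 : Fin 3) 2 1 = 2 by decide,
      show Equiv.swap (1 : Fin 3) 2 2 = 1 by decide] at k1
    rw [show Equiv.swap (0 : Fin 3) 1 0 = 1 by decide, show Equiv.swap (0 : Fin 3) 1 1 = 0 by decide,
      show Equiv.swap (0 : Fin 3) 1 2 = 2 by decide] at k2
    rw [show finRotate 3 0 = 1 by decide, show finRotate 3 1 = 2 by decide,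
      show finRotate 3 2 = 0 by decide] at k3
    rw [show (finRotate 3)⁻¹ 0 = 2 by decide, show (finRotate 3)⁻¹ 1 = 0 by decide,
      show (finRotate 3)⁻¹ 2 = 1 by decide] at k4
    rw [show Equiv.swap (0 : Fin 3) 2 0 = 2 by decide, show Equiv.swap (0 : Fin 3) 2 1 = 1 by decide,
      show Equiv.swap (0 : Fin 3) 2 2 = 0 by decide] at k5
    simp only [hD] at k1 k2 k3 k4 k5
    rcases hmax with e | e | e | e | e <;> linarith
  · push Not at hone
    obtain ⟨τ, hτ, hne⟩ := hone
    obtain ⟨i, j, k, hij, hik, hjk, e1, e2, e3⟩ :=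
      exists_cycle_of_permExponent_eq I.injective J.injective hτ.symm hne.symm
    have hsum : ∀ g : Fin 3 → ℝ, g 0 + g 1 + g 2 = g i + g j + g k := by
      intro g
      have : (Finset.univ : Finset (Fin 3)) = {i, j, k} :=
        (by decide : ∀ i j k : Fin 3, i ≠ j → i ≠ k → j ≠ k → Finset.univ = {i, j, k})
          i j k hij hik hjk
      rw [← Fin.sum_univ_three, this, Finset.sum_insert (by simp [hij, hik]),
        Finset.sum_insert (by simp [hjk]), Finset.sum_singleton, add_assoc]
    have hval' : ∀ τ, permValue (Matrix.of fun i j : Fin n => -D i j / 2) I J τ =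
        -(D (I (τ i)) (J i) + D (I (τ j)) (J j) + D (I (τ k)) (J k)) / 2 := fun τ => by
      rw [hval, hsum fun a => D (I (τ a)) (J a)]
    have hlt : ∀ a b, a ≠ b → permValue (Matrix.of fun i j : Fin n => -D i j / 2) I J σ <
        permValue (Matrix.of fun i j : Fin n => -D i j / 2) I J (σ * Equiv.swap a b) := by
      intro a b hab
      refine hcon _ fun e => ?_
      -- Permutations with equal monomials have equal signs, so composing with a transposition
      -- changes the monomial.
      have hs : σ * Equiv.swap a b ≠ σ := by
        intro e
        exact hab (Equiv.swap_eq_one_iff.1 (by simpa using e))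
      have := (forall_ne_of_permExponent_eq I.injective J.injective e hs).2
      rw [Equiv.Perm.sign_mul, Equiv.Perm.sign_swap hab] at this
      simp at this
    have k1 := hlt i j hij
    have k2 := hlt i k hik
    have k3 := hlt j k hjk
    rw [hval', hval'] at k1 k2 k3
    simp only [Equiv.Perm.mul_apply, Equiv.swap_apply_left, Equiv.swap_apply_right,
      Equiv.swap_apply_of_ne_of_ne hik.symm hjk.symm, Equiv.swap_apply_of_ne_of_ne hij.symm hjk,
      Equiv.swap_apply_of_ne_of_ne hij hik, e1, e2, e3] at k1 k2 k3
    have s1 := hDs (J i) (J j)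
    have s2 := hDs (J i) (J k)
    have s3 := hDs (J j) (J k)
    rcases h.principal_minor (D := D) (fun _ _ => rfl) (J i) (J j) (J k) with e | e | e <;> linarith

/-! ### The tropical convex hull of the matrix of a symbic tree -/

variable {A : Matrix (Fin n) (Fin n) ℝ} {c : Fin n → ℝ}

/-- The position of a point of the tree in the tropical projective torus. -/
noncomputable def treePosition (leaf : Fin n ⊕ Fin n → X) (c : Fin n → ℝ) (x : X) : Fin n → ℝ :=
  fun k => c k - dist x (leaf (Sum.inr k)) / 2

/-- The dual position of a point of the tree. -/
noncomputable def treeCoposition (leaf : Fin n ⊕ Fin n → X) (c : Fin n → ℝ) (x : X) : Fin n → ℝ :=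
  fun i => c i - dist x (leaf (Sum.inl i)) / 2

theorem IsSymbicTree.isSymm (h : IsSymbicTree leaf)
    (hA : ∀ i j, A i j = c i + c j - dist (leaf (Sum.inl i)) (leaf (Sum.inr j)) / 2) :
    A.IsSymm :=
  Matrix.IsSymm.ext fun i j => by rw [hA, hA, h.dist_comm_leaf]; ring

/-- The inequality is the triangle inequality through `x`. Tightness is bicoloredness: seen from
`k'` there is an unprimed leaf beyond `x`, and seen from `i` a primed one. -/
theorem IsSymbicTree.dualPair (h : IsSymbicTree leaf)
    (hA : ∀ i j, A i j = c i + c j - dist (leaf (Sum.inl i)) (leaf (Sum.inr j)) / 2) (x : X) :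
    DualPair A (treePosition leaf c x) (treeCoposition leaf c x) := by
  have hs := h.isSymm hA
  refine ⟨fun k i => ?_, fun k => ?_, fun i => ?_⟩
  · rw [← hs.apply, hA]
    have := dist_triangle (leaf (Sum.inl i)) x (leaf (Sum.inr k))
    rw [dist_comm _ x] at this
    simp only [treePosition, treeCoposition]
    linarith
  · simp only [← hs.apply k, hA, treePosition, treeCoposition]
    by_cases hx : x = leaf (Sum.inr k)
    · refine ⟨k, ?_⟩
      rw [← hx, dist_self, dist_comm x]
      ring
    · obtain ⟨⟨i, hi⟩, -⟩ := h.hasBothColors hx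
      have hi : dist (leaf (Sum.inl i)) x + dist x _ = dist _ _ := hi
      refine ⟨i, ?_⟩
      rw [← hi, dist_comm x (leaf (Sum.inl i))]
      ring
  · simp only [← hs.apply _ i, hA, treePosition, treeCoposition]
    by_cases hx : x = leaf (Sum.inl i)
    · refine ⟨i, ?_⟩
      rw [← hx, dist_self]
      ring
    · obtain ⟨-, k, hk⟩ := h.hasBothColors hx
      have hk : dist (leaf (Sum.inr k)) x + dist x _ = dist _ _ := hk
      refine ⟨k, ?_⟩
      rw [dist_comm (leaf (Sum.inl i)), ← hk, dist_comm x (leaf (Sum.inr k))]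
      ring

/-- Primed leaves beyond `x` and beyond `y` realize the two extreme coordinate differences `± d(x,
y)/2`. -/
theorem IsSymbicTree.dist_treePosition (h : IsSymbicTree leaf) (c : Fin n → ℝ) (x y : X) :
    dist (TropTorus.mk (treePosition leaf c x)) (TropTorus.mk (treePosition leaf c y)) =
      dist x y := by
  by_cases hxy : x = y
  · rw [hxy, dist_self, dist_self]
  obtain ⟨-, k, hk⟩ := h.hasBothColors hxy
  obtain ⟨-, l, hl⟩ := h.hasBothColors (Ne.symm hxy)
  have hk : dist (leaf (Sum.inr k)) x + dist x y = dist (leaf (Sum.inr k)) y := hk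
  have hl : dist (leaf (Sum.inr l)) y + dist y x = dist (leaf (Sum.inr l)) x := hl
  have : NeZero n := ⟨k.pos.ne'⟩
  rw [dist_comm (leaf _) x, dist_comm (leaf _) y] at hk
  rw [dist_comm (leaf _) x, dist_comm (leaf _) y, dist_comm y x] at hl
  rw [TropTorus.dist_mk, hilbertDist_eq_sub (a := -dist x y / 2) (b := dist x y / 2)]
  · ring
  · intro j
    have h1 := dist_triangle x y (leaf (Sum.inr j))
    have h2 := dist_triangle y x (leaf (Sum.inr j))
    rw [dist_comm y x] at h2
    simp only [treePosition]
    constructor <;> linarith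
  · refine ⟨l, ?_⟩
    simp only [treePosition]
    linarith
  · refine ⟨k, ?_⟩
    simp only [treePosition]
    linarith

/-- A tropical combination of two points of a tree lies in the tree. -/
theorem IsMetricTree.exists_min_eq (h : IsMetricTree X) (x y : X) (a b : ℝ) :
    ∃ z e, ∀ w, min (a - dist x w / 2) (b - dist y w / 2) = e - dist z w / 2 := by
  rcases le_or_gt (dist x y / 2) (a - b) with h1 | h1
  · refine ⟨y, b, fun w => min_eq_right ?_⟩
    linarith [dist_triangle x y w]
  rcases le_or_gt (dist x y / 2) (b - a) with h2 | h2
  · refine ⟨x, a, fun w => min_eq_left ?_⟩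
    linarith [dist_triangle y x w, dist_comm x y]
  -- The point `z` is where the two functions of `w` agree on the path; elsewhere the distance
  -- formula for points of a path gives the minimum.
  obtain ⟨z, hz, hz'⟩ := h.exists_dist_eq x y (a := dist x y / 2 + a - b) (by linarith)
    (by linarith)
  have hmem : z ∈ treePath x y := by
    show _ + _ = _
    linarith
  refine ⟨z, a - (dist x y / 2 + a - b) / 2, fun w => ?_⟩
  rw [h.dist_of_mem_treePath hmem, hz, hz']
  rcases max_cases (dist x w - (dist x y / 2 + a - b))
    (dist y w - (dist x y - (dist x y / 2 + a - b))) with e | e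
  · rw [e.1, min_eq_left (by linarith)]
    ring
  · rw [e.1, min_eq_right (by linarith)]
    ring

theorem IsSymbicTree.exists_treePosition_eq [NeZero n] (h : IsSymbicTree leaf)
    (hA : ∀ i j, A i j = c i + c j - dist (leaf (Sum.inl i)) (leaf (Sum.inr j)) / 2)
    {p : TropTorus n} (hp : p ∈ tropHull A) : ∃ x, TropTorus.mk (treePosition leaf c x) = p := by
  obtain ⟨d, rfl⟩ := hp
  have key : ∀ s : Finset (Fin n), ∀ hs : s.Nonempty, ∃ x a, ∀ k,
      s.inf' hs (fun i => d i + A k i) = a + treePosition leaf c x k := by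
    intro s hs
    induction hs using Finset.Nonempty.cons_induction with
    | singleton i =>
      refine ⟨leaf (Sum.inl i), d i + c i, fun k => ?_⟩
      rw [Finset.inf'_singleton, ← (h.isSymm hA).apply, hA, treePosition]
      ring
    | cons i s hi hs ih =>
      obtain ⟨x, a, hx⟩ := ih
      obtain ⟨z, e, hz⟩ := h.tree.exists_min_eq (leaf (Sum.inl i)) x (d i + c i) a
      refine ⟨z, e, fun k => ?_⟩
      have h1 := hz (leaf (Sum.inr k))
      rw [Finset.inf'_cons hs, hx, ← (h.isSymm hA).apply, hA]
      simp only [treePosition]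
      rw [show d i + (c i + c k - dist (leaf (Sum.inl i)) (leaf (Sum.inr k)) / 2) =
          c k + (d i + c i - dist (leaf (Sum.inl i)) (leaf (Sum.inr k)) / 2) by ring,
        show a + (c k - dist x (leaf (Sum.inr k)) / 2) =
          c k + (a - dist x (leaf (Sum.inr k)) / 2) by ring]
      show min _ _ = _
      rw [min_add_add_left, h1]
      ring
  obtain ⟨x, a, hx⟩ := key Finset.univ Finset.univ_nonempty
  refine ⟨x, TropTorus.mk_eq_mk.2 ⟨-a, fun k => ?_⟩⟩
  rw [← Finset.inf'_univ_eq_ciInf, hx]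
  ring

/-- The positions fill the hull because it is generated by the images of the unprimed leaves under
tropical combinations, which stay in the tree. The leaf `j'` has coposition equal to column `j`, so
it goes to the dual of that column. -/
theorem IsSymbicTree.labeledTreeIso [NeZero n] (h : IsSymbicTree leaf) (hs : A.IsSymm)
    (hA : ∀ i j, A i j = c i + c j - dist (leaf (Sum.inl i)) (leaf (Sum.inr j)) / 2) :
    LabeledTreeIso (matrixTree A (rayPoint hs)) leaf := by
  have hcopos : ∀ j, TropTorus.mk (treeCoposition leaf c (leaf (Sum.inr j))) =
      colPoint A j := fun j => by
    refine TropTorus.mk_eq_mk.2 ⟨-c j, fun i => ?_⟩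
    simp only [treeCoposition]
    rw [hA, dist_comm]
    ring
  set Ψ : X → tropHull A := fun x => ⟨TropTorus.mk (treePosition leaf c x), (h.dualPair hA x).mem⟩
    with hΨ
  have hiso : Isometry Ψ := Isometry.of_dist_eq fun x y => h.dist_treePosition c x y
  have hsurj : Function.Surjective Ψ := fun p =>
    (h.exists_treePosition_eq hA p.2).imp fun x hx => Subtype.ext hx
  set e : X ≃ᵢ tropHull A := ⟨Equiv.ofBijective Ψ ⟨hiso.injective, hsurj⟩, hiso⟩
  refine ⟨e.symm, fun s => (e.symm_apply_eq).2 (Subtype.ext ?_)⟩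
  rcases s with i | j
  · refine TropTorus.mk_eq_mk.2 ⟨c i, fun k => ?_⟩
    simp only [treePosition]
    rw [← hs.apply, hA]
    ring
  · show hullDual A (colPoint A j) = TropTorus.mk (treePosition leaf c (leaf (Sum.inr j)))
    rw [← hcopos, ((h.dualPair hA _).symm hs).hullDual_eq hs]

/-- Since the balancing is unique, the distances between columns and rays are those between unprimed
and primed leaves, and these determine the matrix up to scaling. -/
theorem IsSymbicTree.arisesFrom_iff [NeZero n] (h : IsSymbicTree leaf) (hr : HasSymTropRank 2 A) :
    ArisesFrom leaf A ↔ ∃ c : Fin n → ℝ, ∀ i j,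
      A i j = c i + c j - dist (leaf (Sum.inl i)) (leaf (Sum.inr j)) / 2 := by
  constructor
  · rintro ⟨ray, hray, f, hf⟩
    obtain ⟨c, hc⟩ := hr.exists_eq_dist
    refine ⟨c, fun i j => ?_⟩
    rw [hc, ← hf, ← hf, f.dist_eq, hr.eq_rayPoint hray]
    rfl
  · rintro ⟨c, hc⟩
    exact ⟨rayPoint hr.1, hr.isBalancing, h.labeledTreeIso hr.1 hc⟩

end TreeMatrix

theorem mainTheorem1 (n : ℕ) (hn : 1 ≤ n) :
    (∀ A : Matrix (Fin n) (Fin n) ℝ, HasSymTropRank 2 A →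
      (∃! ray : Fin n → tropHull A, IsBalancing A ray) ∧
      ∀ ray : Fin n → tropHull A, IsBalancing A ray → IsSymbicTree (matrixTree A ray)) ∧
    (∀ (X : Type*) [MetricSpace X] (leaf : Fin n ⊕ Fin n → X), IsSymbicTree leaf →
      ∃ A : Matrix (Fin n) (Fin n) ℝ, HasSymTropRank 2 A ∧ ArisesFrom leaf A ∧
        ∀ B : Matrix (Fin n) (Fin n) ℝ, HasSymTropRank 2 B →
          (ArisesFrom leaf B ↔ ∃ c : Fin n → ℝ, ∀ i j, B i j = c i + A i j + c j)) := by
  have : NeZero n := ⟨Nat.one_le_iff_ne_zero.1 hn⟩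
  refine ⟨fun A hA => ⟨⟨rayPoint hA.1, hA.isBalancing, fun _ hray => hA.eq_rayPoint hray⟩,
    fun ray hray => ?_⟩, fun X _ leaf h => ?_⟩
  · rw [hA.eq_rayPoint hray]
    exact hA.isSymbicTree
  · refine ⟨_, h.hasSymTropRank, (h.arisesFrom_iff h.hasSymTropRank).2 ⟨0, fun i j => ?_⟩,
      fun B hB => (h.arisesFrom_iff hB).trans (exists_congr fun c => forall₂_congr fun i j => ?_)⟩
    · simp only [Matrix.of_apply, Pi.zero_apply]
      ring
    · simp only [Matrix.of_apply]
      constructor <;> intro e <;> rw [e] <;> ring
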